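/- **Setting.** There are $K\ge 1$ agents. Agent $k$ has a nonempty local dataset $x_{k,1},\dots,x_{k,N_k}$, a loss $Q_k(w;x)$, and the risk $J_k(w)=\frac1{N_k}\sum_{n=1}^{N_k}Q_k(w;x_{k,n})$, $w\in\mathbb R^M$. Assume: 1. The matrix $A=[a_{\ell k}]\in\mathbb R^{K\times K}$ is symmetric with nonnegative entries, $A^{\sf T}\mathbb 1=\mathbb 1$, and $A$ is primitive. 2. Each $J_k$ is $\nu$-strongly convex for some $\nu>0$; each $Q_k(\cdot;x_{k,n})$ is convex, twice differentiable, and has a $\delta$-Lipschitz gradient. 3. With activation probabilities $q_k\in(0,1]$ and $w^o=\arg\min_w\frac1K\sum_k q_kJ_k(w)$, there are $\kappa,\varepsilon>0$ with $\|\nabla^2J_k(w^o+\Delta w)-\nabla^2J_k(w^o)\|\le\kappa\|\Delta w\|$ for all $k$ and all $\|\Delta w\|\le\varepsilon$. **Algorithm.** Let $T\ge1$ and $\mu>0$. In block $i=0,1,2,\dots$, agent $k$ is active with probability $q_k$. It has step-size $\boldsymbol\mu_{k,i}=\mu$ if it is active and $\boldsymbol\mu_{k,i}=0$ otherwise. For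 $1\le t<T$ let $\boldsymbol A_{iT+t}=I_K$. Let $\boldsymbol A_{(i+1)T}=[\boldsymbol a_{\ell k}]$, where for $\ell\ne k$ one has $\boldsymbol a_{\ell k}=a_{\ell k}$ if $k$ and $\ell$ are both active and $\boldsymbol a_{\ell k}=0$ otherwise, and where $\boldsymbol a_{kk}=1-\sum_{j\ne k,\ j\text{ active}}a_{jk}$ if $k$ is active and $\boldsymbol a_{kk}=1$ otherwise. At every time $iT+t$ each agent $k$ draws $\boldsymbol x_{k,iT+t}$ uniformly from its dataset. All activations and all draws are mutually independent. Starting from $\boldsymbol w_{k,0}=0$, for $t=1,\dots,T$, $$\boldsymbol w_{k,iT+t}=\sum_{\ell}[\boldsymbol A_{iT+t}]_{\ell k}\Big(\boldsymbol w_{\ell,iT+t-1}-\boldsymbol\mu_{\ell,i}\nabla Q_\ell(\boldsymbol w_{\ell,iT+t-1};\boldsymbol x_{\ell,iT+t})\Big).$$ Let $\widetilde{\boldsymbol{\mathcal W}}_n=\mathrm{col}\{w^o-\boldsymbol w_{k,n}\}_{k=1}^K\in\mathbb R^{KM}$, and let $\boldsymbol s_n=\mathrm{col}\{\nabla Q_k(\boldsymbol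 w_{k,n-1};\boldsymbol x_{k,n})-\nabla J_k(\boldsymbol w_{k,n-1})\}_{k=1}^K$ be the gradient noise. **Long-term model.** Put $\boldsymbol{\mathcal A}_n=\boldsymbol A_n\otimes I_M$, $\boldsymbol{\mathcal M}_i=\mathrm{diag}(\boldsymbol\mu_{1,i},\dots,\boldsymbol\mu_{K,i})\otimes I_M$, $\mathcal H=\mathrm{diag}\{\nabla^2J_k(w^o)\}$ and $b=-\mathrm{col}\{\nabla J_k(w^o)\}$. From any fixed deterministic initial vector $\widetilde{\mathcal W}'_0$ (for instance $\widetilde{\mathcal W}_0$), driven by the same $\boldsymbol{\mathcal A}_n,\boldsymbol{\mathcal M}_i,\boldsymbol s_n$, $$\widetilde{\boldsymbol{\mathcal W}}'_{iT+t}=\boldsymbol{\mathcal A}_{iT+t}^{\sf T}(I-\boldsymbol{\mathcal M}_i\mathcal H)\widetilde{\boldsymbol{\mathcal W}}'_{iT+t-1}-\boldsymbol{\mathcal A}_{iT+t}^{\sf T}\boldsymbol{\mathcal M}_ib+\boldsymbol{\mathcal A}_{iT+t}^{\sf T}\boldsymbol{\mathcal M}_i\boldsymbol s_{iT+t}.$$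 **Theorem.** There are $\mu_0>0$ and $C>0$, not depending on $\mu$, such that for every $\mu\in(0,\mu_0)$ and every $t\in\{1,\dots,T\}$ $$\limsup_{i\to\infty}\mathbb E\|\widetilde{\boldsymbol{\mathcal W}}_{iT+t}-\widetilde{\boldsymbol{\mathcal W}}'_{iT+t}\|^2\le C\mu^2,$$ both $\limsup_{i\to\infty}\mathbb E\|\widetilde{\boldsymbol{\mathcal W}}_{iT+t}\|^2$ and $\limsup_{i\to\infty}\mathbb E\|\widetilde{\boldsymbol{\mathcal W}}'_{iT+t}\|^2$ are finite, and $$\Big|\limsup_{i\to\infty}\mathbb E\|\widetilde{\boldsymbol{\mathcal W}}_{iT+t}\|^2-\limsup_{i\to\infty}\mathbb E\|\widetilde{\boldsymbol{\mathcal W}}'_{iT+t}\|^2\Big|\le C\mu^{3/2}.$$ -/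

import Mathlib

open MeasureTheory ProbabilityTheory Filter

namespace DiffusionLearning

/-- The data of the learning problem and of the algorithm, for `K` agents that train models in
`ℝ ^ M` on data points of type `𝒳`.  No property is imposed here except that the local datasets
are nonempty. -/
structure Setup (K M : ℕ) (𝒳 : Type*) where
  /-- size of the local dataset of each agent -/
  N : Fin K → ℕ
  N_pos : ∀ k, 0 < N k
  /-- the local datasets `x_{k,n}` -/
  data : (k : Fin K) → Fin (N k) → 𝒳
  /-- the local losses `Q_k(w; x)` -/
  loss : Fin K → EuclideanSpace ℝ (Fin M) → 𝒳 → ℝ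
  /-- the combination matrix; the entry `(ℓ, k)` scales what `ℓ` sends to `k` -/
  A : Matrix (Fin K) (Fin K) ℝ
  /-- the activation probabilities -/
  q : Fin K → ℝ
  /-- the number of local updates in a block -/
  T : ℕ

namespace Setup

variable {K M : ℕ} {𝒳 : Type*}

/-- The local empirical risk `J_k(w) = (1 / N_k) ∑ₙ Q_k(w; x_{k,n})`. -/
noncomputable def risk (S : Setup K M 𝒳) (k : Fin K) (w : EuclideanSpace ℝ (Fin M)) : ℝ :=
  (1 / (S.N k : ℝ)) * ∑ n, S.loss k w (S.data k n)

/-- The gradient of `Q_k(·; x_{k,n})` at `w`. -/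
noncomputable def lossGrad (S : Setup K M 𝒳) (k : Fin K) (n : Fin (S.N k))
    (w : EuclideanSpace ℝ (Fin M)) : EuclideanSpace ℝ (Fin M) :=
  gradient (fun v => S.loss k v (S.data k n)) w

/-- The gradient of the risk `J_k` at `w`. -/
noncomputable def riskGrad (S : Setup K M 𝒳) (k : Fin K) (w : EuclideanSpace ℝ (Fin M)) :
    EuclideanSpace ℝ (Fin M) :=
  gradient (S.risk k) w

/-- The Hessian of the risk `J_k` at `w`, as a linear operator on `ℝ ^ M`. -/
noncomputable def riskHess (S : Setup K M 𝒳) (k : Fin K) (w : EuclideanSpace ℝ (Fin M)) :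
    EuclideanSpace ℝ (Fin M) →L[ℝ] EuclideanSpace ℝ (Fin M) :=
  fderiv ℝ (S.riskGrad k) w

/-- The activation-weighted risk `(1 / K) ∑ₖ q_k J_k(w)`. -/
noncomputable def weightedRisk (S : Setup K M 𝒳) (w : EuclideanSpace ℝ (Fin M)) : ℝ :=
  (1 / (K : ℝ)) * ∑ k, S.q k * S.risk k w

/-- The combination matrix is symmetric, left-stochastic and primitive. -/
structure CombinationMatrix (S : Setup K M 𝒳) : Prop where
  nonneg : ∀ ℓ k, 0 ≤ S.A ℓ k
  symm : ∀ ℓ k, S.A ℓ k = S.A k ℓ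
  leftStochastic : ∀ k, ∑ ℓ, S.A ℓ k = 1
  primitive : S.A.IsPrimitive

/-- The risks are `ν`-strongly convex, the losses are convex, twice differentiable and have
`δ`-Lipschitz gradients. -/
structure RiskAndLoss (S : Setup K M 𝒳) (ν δ : ℝ) : Prop where
  twiceDifferentiable : ∀ k n,
    Differentiable ℝ (fun w => S.loss k w (S.data k n)) ∧ Differentiable ℝ (S.lossGrad k n)
  stronglyConvex : ∀ k w₁ w₂,
    S.risk k w₁ + inner ℝ (S.riskGrad k w₁) (w₂ - w₁) + ν / 2 * ‖w₂ - w₁‖ ^ 2 ≤ S.risk k w₂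
  convex : ∀ k n w₁ w₂,
    S.loss k w₁ (S.data k n) + inner ℝ (S.lossGrad k n w₁) (w₂ - w₁) ≤ S.loss k w₂ (S.data k n)
  lipschitzGradient : ∀ k n w₁ w₂,
    ‖S.lossGrad k n w₂ - S.lossGrad k n w₁‖ ≤ δ * ‖w₂ - w₁‖

/-- The Hessians of the risks satisfy a Lipschitz condition at `wo`, locally around `wo`. -/
def SmoothHessians (S : Setup K M 𝒳) (wo : EuclideanSpace ℝ (Fin M)) : Prop :=
  ∃ κ > 0, ∃ ε > 0, ∀ k, ∀ Δ : EuclideanSpace ℝ (Fin M), ‖Δ‖ ≤ ε →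
    ‖S.riskHess k (wo + Δ) - S.riskHess k wo‖ ≤ κ * ‖Δ‖

/-- The combination matrix when the set of active agents is `{k | α k = true}`: an active agent
keeps the weights of its active neighbours and adjusts its own weight; an inactive agent keeps
its model. -/
noncomputable def activeMatrix (S : Setup K M 𝒳) (α : Fin K → Bool) :
    Matrix (Fin K) (Fin K) ℝ :=
  fun ℓ k =>
    if ℓ = k then
      (if α k then 1 - ∑ j ∈ Finset.univ.filter (fun j => j ≠ k ∧ α j = true), S.A j k else 1)
    else (if α k ∧ α ℓ then S.A ℓ k else 0)

/-- The matrix `A_{n+1}`.  With `n + 1 = i T + t` and `1 ≤ t ≤ T`, the block is `i = n / T` and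
the position in the block is `t = n % T + 1`; agents combine only at `t = T`. -/
noncomputable def stepMatrix (S : Setup K M 𝒳) (act : ℕ → Fin K → Bool) (n : ℕ) :
    Matrix (Fin K) (Fin K) ℝ :=
  if n % S.T + 1 = S.T then S.activeMatrix (act (n / S.T)) else 1

/-- The step-size of agent `k` in the update from time `n` to time `n + 1`: it is `μ` if `k` is
active in the block `n / T`, and `0` otherwise. -/
noncomputable def stepSize (S : Setup K M 𝒳) (μ : ℝ) (act : ℕ → Fin K → Bool) (n : ℕ)
    (k : Fin K) : ℝ :=
  if act (n / S.T) k then μ else 0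

/-- The models `w_{k,n}` of all agents at time `n`, for one realization of the activations
(`act i k`: agent `k` is active in block `i`) and of the sampled indices (`ξ n k`: the data index
that `k` draws at time `n`). -/
noncomputable def model (S : Setup K M 𝒳) (μ : ℝ) (act : ℕ → Fin K → Bool)
    (ξ : ℕ → (k : Fin K) → Fin (S.N k)) : ℕ → Fin K → EuclideanSpace ℝ (Fin M)
  | 0 => fun _ => 0
  | n + 1 => fun k => ∑ ℓ, S.stepMatrix act n ℓ k •
      (S.model μ act ξ n ℓ
        - S.stepSize μ act n ℓ • S.lossGrad ℓ (ξ (n + 1) ℓ) (S.model μ act ξ n ℓ))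

/-- The error `wo - w_{k,n}` of every agent at time `n`. -/
noncomputable def error (S : Setup K M 𝒳) (wo : EuclideanSpace ℝ (Fin M)) (μ : ℝ)
    (act : ℕ → Fin K → Bool) (ξ : ℕ → (k : Fin K) → Fin (S.N k)) (n : ℕ) (k : Fin K) :
    EuclideanSpace ℝ (Fin M) :=
  wo - S.model μ act ξ n k

/-- The gradient noise `s_{k,n+1}` of the algorithm in the update from time `n` to `n + 1`. -/
noncomputable def gradNoise (S : Setup K M 𝒳) (μ : ℝ) (act : ℕ → Fin K → Bool)
    (ξ : ℕ → (k : Fin K) → Fin (S.N k)) (n : ℕ) (k : Fin K) : EuclideanSpace ℝ (Fin M) :=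
  S.lossGrad k (ξ (n + 1) k) (S.model μ act ξ n k) - S.riskGrad k (S.model μ act ξ n k)

/-- The long-term model started at `v₀`: the error recursion with the Hessians frozen at `wo`,
driven by the same combination matrices, step-sizes and gradient noises as the algorithm and by
the bias `b_k = - ∇ J_k(wo)`. -/
noncomputable def longTerm (S : Setup K M 𝒳) (wo : EuclideanSpace ℝ (Fin M))
    (v₀ : Fin K → EuclideanSpace ℝ (Fin M)) (μ : ℝ) (act : ℕ → Fin K → Bool)
    (ξ : ℕ → (k : Fin K) → Fin (S.N k)) : ℕ → Fin K → EuclideanSpace ℝ (Fin M)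
  | 0 => v₀
  | n + 1 => fun k => ∑ ℓ, S.stepMatrix act n ℓ k •
      (S.longTerm wo v₀ μ act ξ n ℓ
        - S.stepSize μ act n ℓ • S.riskHess ℓ wo (S.longTerm wo v₀ μ act ξ n ℓ)
        - S.stepSize μ act n ℓ • (-S.riskGrad ℓ wo)
        + S.stepSize μ act n ℓ • S.gradNoise μ act ξ n ℓ)

/-- The random environment: agent `k` is active in block `i` with probability `q_k`, the index
`ξ n k` is uniform on the local dataset of `k`, and all of these random variables are mutually
independent. -/
structure Environment (S : Setup K M 𝒳) {Ω : Type*} [MeasurableSpace Ω] (P : Measure Ω)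
    (act : ℕ → Fin K → Ω → Bool) (ξ : ℕ → (k : Fin K) → Ω → Fin (S.N k)) : Prop where
  measurable_act : ∀ i k, Measurable (act i k)
  measurable_sample : ∀ n k, Measurable (ξ n k)
  prob_act : ∀ i k, P {ω | act i k ω = true} = ENNReal.ofReal (S.q k)
  prob_sample : ∀ n k j, P {ω | ξ n k ω = j} = (S.N k : ENNReal)⁻¹
  indep : iIndep
    (Sum.elim (fun p : ℕ × Fin K => MeasurableSpace.comap (act p.1 p.2) ⊤)
      (fun p : ℕ × Fin K => MeasurableSpace.comap (ξ p.1 p.2) ⊤)) P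

end Setup

/-- `E ‖X‖²` for a random block vector `X = col{X_1, …, X_K}`, with the Euclidean norm of
`ℝ ^ (K M)`. -/
noncomputable def meanSquare {K M : ℕ} {Ω : Type*} [MeasurableSpace Ω] (P : Measure Ω)
    (X : Ω → Fin K → EuclideanSpace ℝ (Fin M)) : ENNReal :=
  ∫⁻ ω, ∑ k, ENNReal.ofReal (‖X ω k‖ ^ 2) ∂P

end DiffusionLearning

/-!
Write `Y` for the deviation of the models from `wo` at the start of a block.  The gap between the
error and the long-term model obeys a *noise-free* linear recursion (`longTermGap_succ`): the
gradient noises cancel and only the linearization errors of the risk gradients remain, which are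
`O(‖deviation‖²)` (`RiskAndLoss.exists_norm_riskGrad_sub_le`).  The local steps with the Hessians at
`wo` never expand, they contract by `1 - μ ν / 2` when all agents are active, an event of probability
`∏ q_k > 0`, and mixing never expands.  So the mean-square gap is `O(μ²)` as soon as the fourth
moment of the deviation is `O(μ²)`, and the rest follows from Young's inequality
(`second_moments_close`).

For the fourth moment, the local trajectories of a block are compared with those started at `wo` and
driven by the *same* data points.  A gradient step of a smooth convex function is nonexpansive
(`norm_gradientStep_sub_le`), so the difference of the trajectories never grows, while the
trajectory from `wo` moves by `O(μ)` and does not depend on `Y`.  If `B` is the combination matrix,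
the block takes `Y` to `B X + B c` with `‖X‖ ≤ ‖Y‖` and `‖c‖ = O(μ)`.  Three facts give a
contraction of `E ‖Y‖⁴` by a factor `1 - a μ` with `a > 0`, up to an error `O(μ³)`, hence `O(μ²)` in
the steady state (`Environment.exists_fourth_moment_le`):

* under full activity, `E ‖X‖²` contracts by strong convexity of the risks
  (`Environment.integral_contraction_ge`);
* under full activity, mixing loses a fixed fraction of the squared disagreement of the agents,
  since the combination matrix is primitive (`exists_norm_mix_sq_le`);
* in the cross term `⟪B X, B c⟫`, the part along the mean of `Y` averages to `O(μ²)`, because the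
  drift at `wo` is the gradient of the weighted risk, which vanishes
  (`Environment.integral_drift_eq_zero`); the remaining part is `O(μ)` times the disagreement and is
  absorbed by the second fact.

The state at the start of a block is independent of the randomness in the block.  All random
variables take finitely many values, which settles measurability and integrability
(`FinitelyMeasurable`).
-/

namespace DiffusionLearning

/-! ### Gradient steps of smooth convex functions -/

section GradientStep

variable {E : Type*} [NormedAddCommGroup E] [InnerProductSpace ℝ E]

/-- The gradient of a smooth convex function is cocoercive.  Differentiability is not needed: the
convexity inequality at the two endpoints bounds `f z - f y - ⟪g y, z - y⟫` by `δ ‖z - y‖²`, which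
replaces the descent lemma at the price of a factor `2`. -/
lemma cocoercive_of_convex {f : E → ℝ} {g : E → E} {δ : ℝ} (hδ : 0 < δ)
    (hconv : ∀ x y, f x + inner ℝ (g x) (y - x) ≤ f y)
    (hlip : ∀ x y, ‖g y - g x‖ ≤ δ * ‖y - x‖) (x y : E) :
    ‖g y - g x‖ ^ 2 ≤ 2 * δ * inner ℝ (g y - g x) (y - x) := by
  have hup : ∀ y z, f z ≤ f y + inner ℝ (g y) (z - y) + δ * ‖z - y‖ ^ 2 := by
    intro y z
    have h1 := hconv z y
    have h2 : inner ℝ (g z - g y) (z - y) ≤ δ * ‖z - y‖ * ‖z - y‖ :=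
      (real_inner_le_norm _ _).trans (mul_le_mul_of_nonneg_right (hlip y z) (norm_nonneg _))
    have h3 : inner ℝ (g z) (y - z) = - inner ℝ (g z) (z - y) := by
      rw [← inner_neg_right, neg_sub]
    rw [inner_sub_left] at h2
    nlinarith
  have key : ∀ x y, f x + inner ℝ (g x) (y - x) + ‖g y - g x‖ ^ 2 / (4 * δ) ≤ f y := by
    intro x y
    set d := g y - g x with hd
    have h1 := hconv x (y - (1 / (2 * δ)) • d)
    have h2 := hup y (y - (1 / (2 * δ)) • d)
    have e1 : y - (1 / (2 * δ)) • d - y = -((1 / (2 * δ)) • d) := by abel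
    have e2 : y - (1 / (2 * δ)) • d - x = (y - x) - (1 / (2 * δ)) • d := by abel
    rw [e1, inner_neg_right, inner_smul_right, norm_neg, norm_smul, Real.norm_eq_abs,
      abs_of_pos (by positivity)] at h2
    rw [e2, inner_sub_right, inner_smul_right] at h1
    have e3 : inner ℝ (g y) d - inner ℝ (g x) d = ‖d‖ ^ 2 := by
      rw [← inner_sub_left, ← hd, real_inner_self_eq_norm_sq]
    have e4 : inner ℝ (g y) d = inner ℝ (g x) d + ‖d‖ ^ 2 := by linarith
    rw [e4] at h2
    have e5 : δ * (1 / (2 * δ) * ‖d‖) ^ 2 = ‖d‖ ^ 2 / (4 * δ) := by field_simp; ring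
    have e6 : 1 / (2 * δ) * (inner ℝ (g x) d + ‖d‖ ^ 2)
        = 1 / (2 * δ) * inner ℝ (g x) d + 2 * (‖d‖ ^ 2 / (4 * δ)) := by field_simp; ring
    linarith
  have h1 := key x y
  have h2 := key y x
  rw [norm_sub_rev] at h2
  have h3 : inner ℝ (g y) (x - y) = - inner ℝ (g y) (y - x) := by
    rw [← inner_neg_right, neg_sub]
  rw [inner_sub_left]
  have h4 : ‖g y - g x‖ ^ 2 / (4 * δ) * (4 * δ) = ‖g y - g x‖ ^ 2 := by field_simp
  nlinarith

/-- Gradient steps of a smooth convex function do not expand distances. -/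
lemma norm_gradientStep_sub_le {f : E → ℝ} {g : E → E} {δ : ℝ} (hδ : 0 < δ)
    (hconv : ∀ x y, f x + inner ℝ (g x) (y - x) ≤ f y)
    (hlip : ∀ x y, ‖g y - g x‖ ≤ δ * ‖y - x‖) {s : ℝ} (hs : 0 ≤ s) (hsδ : s * δ ≤ 1) (x y : E) :
    ‖(y - s • g y) - (x - s • g x)‖ ≤ ‖y - x‖ := by
  have h := cocoercive_of_convex hδ hconv hlip x y
  have e : (y - s • g y) - (x - s • g x) = (y - x) - s • (g y - g x) := by
    rw [smul_sub]; abel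
  have h0 : 0 ≤ inner ℝ (g y - g x) (y - x) := by
    have := sq_nonneg ‖g y - g x‖
    by_contra hneg
    nlinarith
  refine le_of_sq_le_sq ?_ (norm_nonneg _)
  rw [e, norm_sub_sq_real, inner_smul_right, real_inner_comm, norm_smul, mul_pow,
    Real.norm_eq_abs, sq_abs]
  have : s ^ 2 * ‖g y - g x‖ ^ 2 ≤ s * (s * δ) * (2 * inner ℝ (g y - g x) (y - x)) := by
    nlinarith [mul_le_mul_of_nonneg_left h (sq_nonneg s)]
  have : s * (s * δ) * (2 * inner ℝ (g y - g x) (y - x))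
      ≤ s * 1 * (2 * inner ℝ (g y - g x) (y - x)) := by gcongr
  linarith

end GradientStep

/-! ### Mixing with doubly stochastic matrices -/

section Mixing

variable {ι : Type*} [Fintype ι]
variable {E : Type*} [NormedAddCommGroup E] [InnerProductSpace ℝ E]

/-- The action of `Bᵀ ⊗ I` on a block vector, whose blocks lie in `E`: block `ℓ` enters block `k`
with the weight `B ℓ k`. -/
noncomputable def mix (B : Matrix ι ι ℝ) (x : PiLp 2 (fun _ : ι => E)) : PiLp 2 (fun _ : ι => E) :=
  WithLp.toLp 2 fun k => ∑ ℓ, B ℓ k • x ℓ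

@[simp] lemma mix_apply (B : Matrix ι ι ℝ) (x : PiLp 2 (fun _ : ι => E)) (k : ι) :
    mix B x k = ∑ ℓ, B ℓ k • x ℓ := rfl

lemma mix_add (B : Matrix ι ι ℝ) (x y : PiLp 2 (fun _ : ι => E)) :
    mix B (x + y) = mix B x + mix B y := by
  ext k; simp [smul_add, Finset.sum_add_distrib]

lemma mix_sub (B : Matrix ι ι ℝ) (x y : PiLp 2 (fun _ : ι => E)) :
    mix B (x - y) = mix B x - mix B y := by
  ext k; simp [smul_sub, Finset.sum_sub_distrib]

lemma mix_mix (B C : Matrix ι ι ℝ) (x : PiLp 2 (fun _ : ι => E)) :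
    mix C (mix B x) = mix (B * C) x := by
  ext k
  simp only [mix_apply, Finset.smul_sum, smul_smul, Matrix.mul_apply, Finset.sum_smul]
  rw [Finset.sum_comm]
  simp only [mul_comm]

lemma mix_one [DecidableEq ι] (x : PiLp 2 (fun _ : ι => E)) :
    mix (1 : Matrix ι ι ℝ) x = x := by
  ext k
  simp [Matrix.one_apply]

lemma inner_mix_left (B : Matrix ι ι ℝ) (x y : PiLp 2 (fun _ : ι => E)) :
    inner ℝ (mix B x) y = inner ℝ x (mix B.transpose y) := by
  simp only [PiLp.inner_apply, mix_apply, sum_inner, inner_sum, inner_smul_left, inner_smul_right,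
    Matrix.transpose_apply]
  rw [Finset.sum_comm]
  rfl

/-- The losses of squared norm decrease along the powers of a symmetric matrix. -/
lemma norm_mix_sq_sub_le {A : Matrix ι ι ℝ} (hsymm : A.transpose = A)
    (x : PiLp 2 (fun _ : ι => E)) :
    ‖mix A x‖ ^ 2 - ‖mix A (mix A x)‖ ^ 2 ≤ ‖x‖ ^ 2 - ‖mix A x‖ ^ 2 := by
  have h1 : ‖mix A x‖ ^ 2 = inner ℝ x (mix A (mix A x)) := by
    rw [← real_inner_self_eq_norm_sq, inner_mix_left, hsymm]
  have h2 := real_inner_le_norm x (mix A (mix A x))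
  nlinarith [sq_nonneg (‖x‖ - ‖mix A (mix A x)‖)]

/-- The matrix with all entries `1 / |ι|`; mixing with it replaces every block by the mean of all
blocks. -/
noncomputable def meanMatrix (ι : Type*) [Fintype ι] : Matrix ι ι ℝ :=
  fun _ _ => 1 / (Fintype.card ι : ℝ)

lemma meanMatrix_transpose : (meanMatrix ι).transpose = meanMatrix ι := rfl

variable [DecidableEq ι]

/-- The variance identity: the squared norm lost in mixing is the total weighted spread of the
mixed blocks around their weighted means. -/
lemma norm_sq_sub_norm_mix_sq {B : Matrix ι ι ℝ} (hB : B ∈ doublyStochastic ℝ ι)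
    (x : PiLp 2 (fun _ : ι => E)) :
    ‖x‖ ^ 2 - ‖mix B x‖ ^ 2 = ∑ k, ∑ ℓ, B ℓ k * ‖x ℓ - mix B x k‖ ^ 2 := by
  have h1 : ∀ k, ∑ ℓ, B ℓ k * ‖x ℓ - mix B x k‖ ^ 2
      = ∑ ℓ, B ℓ k * ‖x ℓ‖ ^ 2 - ‖mix B x k‖ ^ 2 := by
    intro k
    have h2 : inner ℝ (∑ ℓ, B ℓ k • x ℓ) (mix B x k) = ‖mix B x k‖ ^ 2 := by
      rw [← mix_apply, real_inner_self_eq_norm_sq]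
    rw [sum_inner] at h2
    simp only [real_inner_smul_left] at h2
    have h3 : ∑ ℓ, B ℓ k = 1 := sum_col_of_mem_doublyStochastic hB k
    have h4 : ∀ ℓ, B ℓ k * ‖x ℓ - mix B x k‖ ^ 2 = B ℓ k * ‖x ℓ‖ ^ 2
        - 2 * (B ℓ k * inner ℝ (x ℓ) (mix B x k)) + B ℓ k * ‖mix B x k‖ ^ 2 := by
      intro ℓ
      rw [norm_sub_sq_real]; ring
    rw [Finset.sum_congr rfl fun ℓ _ => h4 ℓ, Finset.sum_add_distrib, Finset.sum_sub_distrib,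
      ← Finset.mul_sum, h2, ← Finset.sum_mul, h3]
    ring
  rw [Finset.sum_congr rfl fun k _ => h1 k, Finset.sum_sub_distrib, Finset.sum_comm,
    PiLp.norm_sq_eq_of_L2, PiLp.norm_sq_eq_of_L2]
  congr 1
  refine Finset.sum_congr rfl fun ℓ _ => ?_
  rw [← Finset.sum_mul, sum_row_of_mem_doublyStochastic hB, one_mul]

lemma norm_mix_le {B : Matrix ι ι ℝ} (hB : B ∈ doublyStochastic ℝ ι)
    (x : PiLp 2 (fun _ : ι => E)) : ‖mix B x‖ ≤ ‖x‖ := by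
  refine le_of_sq_le_sq ?_ (norm_nonneg _)
  have h := norm_sq_sub_norm_mix_sq hB x
  have : 0 ≤ ∑ k, ∑ ℓ, B ℓ k * ‖x ℓ - mix B x k‖ ^ 2 :=
    Finset.sum_nonneg fun k _ => Finset.sum_nonneg fun ℓ _ =>
      mul_nonneg (nonneg_of_mem_doublyStochastic hB) (sq_nonneg _)
  linarith

lemma meanMatrix_mem [Nonempty ι] : meanMatrix ι ∈ doublyStochastic ℝ ι := by
  rw [mem_doublyStochastic_iff_sum]
  refine ⟨fun i j => by simp only [meanMatrix]; positivity, fun i => ?_, fun i => ?_⟩ <;>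
  · simp [meanMatrix]

lemma mul_meanMatrix {B : Matrix ι ι ℝ} (hB : B ∈ doublyStochastic ℝ ι) :
    B * meanMatrix ι = meanMatrix ι := by
  ext i j
  simp only [Matrix.mul_apply, meanMatrix, ← Finset.sum_mul,
    sum_row_of_mem_doublyStochastic hB, one_mul]

lemma meanMatrix_mul {B : Matrix ι ι ℝ} (hB : B ∈ doublyStochastic ℝ ι) :
    meanMatrix ι * B = meanMatrix ι := by
  ext i j
  simp only [Matrix.mul_apply, meanMatrix, ← Finset.mul_sum,
    sum_col_of_mem_doublyStochastic hB, mul_one]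

lemma norm_sq_sub_norm_mix_pow_sq_le {A : Matrix ι ι ℝ} (hsymm : A.transpose = A) (m : ℕ)
    (x : PiLp 2 (fun _ : ι => E)) :
    ‖x‖ ^ 2 - ‖mix (A ^ m) x‖ ^ 2 ≤ m * (‖x‖ ^ 2 - ‖mix A x‖ ^ 2) := by
  have step : ∀ j, ‖mix (A ^ j) x‖ ^ 2 - ‖mix (A ^ (j + 1)) x‖ ^ 2
      ≤ ‖x‖ ^ 2 - ‖mix A x‖ ^ 2 := by
    intro j
    induction j with
    | zero => simp [mix_one]
    | succ j ih =>
      refine le_trans ?_ ih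
      have := norm_mix_sq_sub_le hsymm (mix (A ^ j) x)
      simpa only [mix_mix, pow_succ, mul_assoc] using this
  induction m with
  | zero => simp [mix_one]
  | succ m ih =>
    have := step m
    push_cast
    linarith

/-- Mixing with a primitive symmetric doubly stochastic matrix contracts the disagreement of the
blocks.  Some power has positive entries, and by the variance identity it loses a fixed fraction
of the disagreement; one factor loses at least the average loss per factor. -/
lemma exists_norm_mix_sq_le [Nonempty ι] {A : Matrix ι ι ℝ} (hA : A ∈ doublyStochastic ℝ ι)
    (hsymm : A.transpose = A) (hprim : A.IsPrimitive) :
    ∃ c > 0, ∀ x : PiLp 2 (fun _ : ι => E),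
      ‖mix A x‖ ^ 2 ≤ ‖x‖ ^ 2 - c * ‖x - mix (meanMatrix ι) x‖ ^ 2 := by
  obtain ⟨-, m, hm, hpos⟩ := hprim
  have hB : A ^ m ∈ doublyStochastic ℝ ι := pow_mem hA m
  obtain ⟨p, -, hp⟩ := Finset.exists_min_image (Finset.univ : Finset (ι × ι))
    (fun p => (A ^ m) p.1 p.2) Finset.univ_nonempty
  have hb : 0 < (A ^ m) p.1 p.2 := hpos _ _
  set b := (A ^ m) p.1 p.2
  refine ⟨b / m, by positivity, fun x => ?_⟩
  have h1 := norm_sq_sub_norm_mix_sq hB x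
  have h2 := norm_sq_sub_norm_mix_pow_sq_le hsymm m x
  set P := mix (meanMatrix ι) x with hP
  obtain ⟨k₀⟩ := ‹Nonempty ι›
  -- the mean minimizes the spread, so one column of the power already controls the disagreement
  have h4 : ∀ c : E, ‖x - P‖ ^ 2 ≤ ∑ ℓ, ‖x ℓ - c‖ ^ 2 := by
    intro c
    rw [PiLp.norm_sq_eq_of_L2]
    have hPk : ∀ ℓ, P ℓ = P k₀ := fun ℓ => by simp [hP, meanMatrix]
    have hsum : ∑ ℓ, (x ℓ - P ℓ) = 0 := by
      have hc : (Fintype.card ι : ℝ) ≠ 0 := by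
        have : Nonempty ι := ⟨k₀⟩
        exact_mod_cast Fintype.card_ne_zero
      simp only [hP, mix_apply, meanMatrix, ← Finset.smul_sum]
      rw [Finset.sum_sub_distrib, Finset.sum_const, Finset.card_univ, ← Nat.cast_smul_eq_nsmul ℝ,
        smul_smul, mul_one_div_cancel hc, one_smul, sub_self]
    have h5 : ∀ ℓ, ‖x ℓ - c‖ ^ 2 = ‖x ℓ - P ℓ‖ ^ 2 + 2 * inner ℝ (x ℓ - P ℓ) (P k₀ - c)
        + ‖P k₀ - c‖ ^ 2 := by
      intro ℓ
      rw [← norm_add_sq_real, hPk ℓ]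
      congr 2
      abel
    rw [Finset.sum_congr rfl fun ℓ _ => h5 ℓ, Finset.sum_add_distrib, Finset.sum_add_distrib,
      ← Finset.mul_sum, ← sum_inner, hsum, inner_zero_left]
    have : 0 ≤ ∑ _ℓ : ι, ‖P k₀ - c‖ ^ 2 := Finset.sum_nonneg fun _ _ => sq_nonneg _
    simp only [PiLp.sub_apply]
    linarith
  have h6 : b * ‖x - P‖ ^ 2 ≤ ∑ k, ∑ ℓ, (A ^ m) ℓ k * ‖x ℓ - mix (A ^ m) x k‖ ^ 2 := by
    calc b * ‖x - P‖ ^ 2 ≤ b * ∑ ℓ, ‖x ℓ - mix (A ^ m) x k₀‖ ^ 2 := by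
          gcongr; exact h4 _
      _ = ∑ ℓ, b * ‖x ℓ - mix (A ^ m) x k₀‖ ^ 2 := Finset.mul_sum _ _ _
      _ ≤ ∑ ℓ, (A ^ m) ℓ k₀ * ‖x ℓ - mix (A ^ m) x k₀‖ ^ 2 :=
          Finset.sum_le_sum fun ℓ _ => mul_le_mul_of_nonneg_right
            (hp (ℓ, k₀) (Finset.mem_univ _)) (sq_nonneg _)
      _ ≤ _ := Finset.single_le_sum
          (f := fun k => ∑ ℓ, (A ^ m) ℓ k * ‖x ℓ - mix (A ^ m) x k‖ ^ 2)
          (fun k _ => Finset.sum_nonneg fun ℓ _ =>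
            mul_nonneg (hpos _ _).le (sq_nonneg _)) (Finset.mem_univ k₀)
  have hm' : (0 : ℝ) < m := by exact_mod_cast hm
  have h7 : b * ‖x - P‖ ^ 2 ≤ m * (‖x‖ ^ 2 - ‖mix A x‖ ^ 2) := by linarith
  have h8 : b / m * ‖x - P‖ ^ 2 = b * ‖x - P‖ ^ 2 / m := by ring
  rw [h8]
  have := (div_le_iff₀' hm').2 h7
  linarith

end Mixing

/-! ### Local stochastic gradient descent -/

section LocalDescent

variable {E : Type*} [NormedAddCommGroup E] [InnerProductSpace ℝ E]

/-- Gradient descent with step-size `s` from the initial point `x`, where the `t`-th step follows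
the gradient field `g t`. -/
def localDescent (s : ℝ) (g : ℕ → E → E) (x : E) : ℕ → E
  | 0 => x
  | t + 1 => localDescent s g x t - s • g t (localDescent s g x t)

variable {s δ G : ℝ} {g : ℕ → E → E}

lemma norm_localDescent_sub_le_of_le
    (hne : ∀ t x y, ‖(y - s • g t y) - (x - s • g t x)‖ ≤ ‖y - x‖) (x y : E) {r t : ℕ}
    (hrt : r ≤ t) :
    ‖localDescent s g y t - localDescent s g x t‖
      ≤ ‖localDescent s g y r - localDescent s g x r‖ := by
  induction t, hrt using Nat.le_induction with
  | base => exact le_rfl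
  | succ t _ ih => exact (hne t _ _).trans ih

lemma norm_localDescent_sub_le
    (hne : ∀ t x y, ‖(y - s • g t y) - (x - s • g t x)‖ ≤ ‖y - x‖) (x y : E) (t : ℕ) :
    ‖localDescent s g y t - localDescent s g x t‖ ≤ ‖y - x‖ :=
  norm_localDescent_sub_le_of_le hne x y (Nat.zero_le t)

lemma norm_localDescent_sub_self_le (hs : 0 ≤ s)
    (hne : ∀ t x y, ‖(y - s • g t y) - (x - s • g t x)‖ ≤ ‖y - x‖) {x : E}
    (hG : ∀ t, ‖g t x‖ ≤ G) (t : ℕ) :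
    ‖localDescent s g x t - x‖ ≤ t * (s * G) := by
  induction t with
  | zero => simp [localDescent]
  | succ t ih =>
    have e : localDescent s g x (t + 1) - x
        = ((localDescent s g x t - s • g t (localDescent s g x t)) - (x - s • g t x))
          - s • g t x := by
      simp only [localDescent]; abel
    have h1 := (hne t x (localDescent s g x t)).trans ih
    have h2 : ‖s • g t x‖ ≤ s * G := by
      rw [norm_smul, Real.norm_eq_abs, abs_of_nonneg hs]; gcongr; exact hG t
    rw [e]
    push_cast
    calc _ ≤ _ := norm_sub_le _ _
      _ ≤ _ := by linarith

lemma norm_localDescent_sub_sub_le (hs : 0 ≤ s) (hδ : 0 ≤ δ)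
    (hne : ∀ t x y, ‖(y - s • g t y) - (x - s • g t x)‖ ≤ ‖y - x‖)
    (hlip : ∀ t x y, ‖g t y - g t x‖ ≤ δ * ‖y - x‖) (x y : E) (t : ℕ) :
    ‖(localDescent s g y t - localDescent s g x t) - (y - x)‖ ≤ t * (s * δ * ‖y - x‖) := by
  induction t with
  | zero => simp [localDescent]
  | succ t ih =>
    have e : (localDescent s g y (t + 1) - localDescent s g x (t + 1)) - (y - x)
        = ((localDescent s g y t - localDescent s g x t) - (y - x))
          - s • (g t (localDescent s g y t) - g t (localDescent s g x t)) := by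
      simp only [localDescent, smul_sub]; abel
    have h2 : ‖s • (g t (localDescent s g y t) - g t (localDescent s g x t))‖
        ≤ s * δ * ‖y - x‖ := by
      rw [norm_smul, Real.norm_eq_abs, abs_of_nonneg hs, mul_assoc]
      gcongr
      refine (hlip t _ _).trans ?_
      gcongr
      exact norm_localDescent_sub_le hne x y t
    rw [e]
    push_cast
    calc _ ≤ _ := norm_sub_le _ _
      _ ≤ _ := by linarith

/-- To first order in the step-size, descent moves along the sum of the gradients at the initial
point. -/
lemma norm_localDescent_sub_self_add_le (hs : 0 ≤ s) (hδ : 0 ≤ δ) (hG0 : 0 ≤ G)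
    (hne : ∀ t x y, ‖(y - s • g t y) - (x - s • g t x)‖ ≤ ‖y - x‖)
    (hlip : ∀ t x y, ‖g t y - g t x‖ ≤ δ * ‖y - x‖) {x : E} (hG : ∀ t, ‖g t x‖ ≤ G) (t : ℕ) :
    ‖(localDescent s g x t - x) + s • ∑ j ∈ Finset.range t, g j x‖
      ≤ t ^ 2 * (δ * G * s ^ 2) := by
  induction t with
  | zero => simp [localDescent]
  | succ t ih =>
    have e : (localDescent s g x (t + 1) - x) + s • ∑ j ∈ Finset.range (t + 1), g j x
        = ((localDescent s g x t - x) + s • ∑ j ∈ Finset.range t, g j x)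
          - s • (g t (localDescent s g x t) - g t x) := by
      simp only [localDescent, smul_sub, Finset.sum_range_succ, smul_add]; abel
    have h2 : ‖s • (g t (localDescent s g x t) - g t x)‖ ≤ t * (δ * G * s ^ 2) := by
      rw [norm_smul, Real.norm_eq_abs, abs_of_nonneg hs]
      have h3 := (hlip t x (localDescent s g x t)).trans
        (mul_le_mul_of_nonneg_left (norm_localDescent_sub_self_le hs hne hG t) hδ)
      calc _ ≤ s * (δ * (t * (s * G))) := by gcongr
        _ = _ := by ring
    have h4 : 0 ≤ (t + 1) * (δ * G * s ^ 2) := by positivity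
    rw [e]
    push_cast
    calc _ ≤ _ := norm_sub_le _ _
      _ ≤ _ := by nlinarith

end LocalDescent

/-! ### Pathwise change of the fourth moment over a block -/

section Drift

lemma norm_add_pow_four_le {H : Type*} [NormedAddCommGroup H] [InnerProductSpace ℝ H] (z r : H) :
    ‖z + r‖ ^ 4 ≤ ‖z‖ ^ 4 + 4 * (‖z‖ ^ 2 * inner ℝ z r) + 8 * (‖z‖ ^ 2 * ‖r‖ ^ 2)
      + 3 * ‖r‖ ^ 4 := by
  have h1 : ‖z + r‖ ^ 4 = (‖z‖ ^ 2 + 2 * inner ℝ z r + ‖r‖ ^ 2) ^ 2 := by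
    rw [← norm_add_sq_real]; ring
  have h2 : inner ℝ z r ^ 2 ≤ ‖z‖ ^ 2 * ‖r‖ ^ 2 := by
    rw [← mul_pow]
    exact sq_le_sq' (by linarith [neg_le_of_abs_le (abs_real_inner_le_norm z r)])
      (real_inner_le_norm z r)
  rw [h1]
  nlinarith [sq_nonneg (inner ℝ z r - ‖r‖ ^ 2)]

variable {ι : Type*} [Fintype ι] [DecidableEq ι]
variable {E : Type*} [NormedAddCommGroup E] [InnerProductSpace ℝ E]

/-- A block of the algorithm takes `Y` to `mix B X + mix B c`, where `X` is the difference of the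
local trajectories from `Y` and from `0`, and `c` is the displacement of the latter.  In the cross
term of the fourth power, `mix B X` is replaced by the mean of `Y`, at a cost controlled by the
disagreement of `Y`. -/
lemma norm_block_pow_four_le {B : Matrix ι ι ℝ} (hB : B ∈ doublyStochastic ℝ ι)
    {Y X c : PiLp 2 (fun _ : ι => E)} {μ a r : ℝ} (hμ : 0 ≤ μ) (ha : 0 ≤ a) (hr : 0 ≤ r)
    (hX : ‖X‖ ≤ ‖Y‖) (hXY : ‖X - Y‖ ≤ a * μ * ‖Y‖) (hc : ‖c‖ ≤ r * μ) :
    ‖mix B X + mix B c‖ ^ 4 ≤ ‖Y‖ ^ 2 * ‖mix B X‖ ^ 2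
      + 4 * (‖Y‖ ^ 2 * inner ℝ (mix (meanMatrix ι) Y) c)
      + ‖Y‖ ^ 2 * (12 * a * r * μ ^ 2 * ‖Y‖ + 20 * r * μ * ‖Y - mix (meanMatrix ι) Y‖
        + 8 * r ^ 2 * μ ^ 2) + 3 * r ^ 4 * μ ^ 4 := by
  set P := mix (meanMatrix ι) Y with hP
  set Z := mix B X with hZ
  set R := mix B c with hR
  have hZY : ‖Z‖ ≤ ‖Y‖ := (norm_mix_le hB X).trans hX
  have hRr : ‖R‖ ≤ r * μ := (norm_mix_le hB c).trans hc
  have hBP : mix B P = P := by rw [hP, mix_mix, meanMatrix_mul hB]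
  have hZP : ‖Z - P‖ ≤ a * μ * ‖Y‖ + ‖Y - P‖ := by
    have e : Z - P = mix B (X - Y) + mix B (Y - P) := by
      rw [mix_sub, mix_sub, hBP]; abel
    rw [e]
    exact (norm_add_le _ _).trans
      (add_le_add ((norm_mix_le hB _).trans hXY) (norm_mix_le hB _))
  have hYZ : ‖Y‖ - ‖Z‖ ≤ a * μ * ‖Y‖ + 2 * ‖Y - P‖ := by
    have h1 : ‖Y‖ ≤ ‖Y - P‖ + ‖P‖ := by simpa using norm_add_le (Y - P) P
    have h2 : ‖P‖ ≤ ‖Z - P‖ + ‖Z‖ := by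
      have := norm_sub_le Z (Z - P)
      rw [sub_sub_cancel] at this; linarith
    linarith
  have hPR : inner ℝ P R = inner ℝ P c := by
    have hrow : B * meanMatrix ι = meanMatrix ι := mul_meanMatrix hB
    rw [hP, inner_mix_left, inner_mix_left, meanMatrix_transpose, hR, mix_mix, hrow]
  have hin : inner ℝ Z R ≤ inner ℝ P c + (a * μ * ‖Y‖ + ‖Y - P‖) * (r * μ) := by
    have e : inner ℝ Z R = inner ℝ P R + inner ℝ (Z - P) R := by rw [← inner_add_left]; simp
    rw [e, hPR]
    gcongr
    refine (real_inner_le_norm _ _).trans ?_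
    gcongr
  have habs : -inner ℝ Z R ≤ ‖Y‖ * (r * μ) := by
    refine (neg_le_abs _).trans ((abs_real_inner_le_norm _ _).trans ?_)
    gcongr
  have hsq : ‖Y‖ ^ 2 - ‖Z‖ ^ 2 ≤ 2 * ‖Y‖ * (a * μ * ‖Y‖ + 2 * ‖Y - P‖) := by
    calc ‖Y‖ ^ 2 - ‖Z‖ ^ 2 = (‖Y‖ + ‖Z‖) * (‖Y‖ - ‖Z‖) := by ring
      _ ≤ (2 * ‖Y‖) * (‖Y‖ - ‖Z‖) :=
        mul_le_mul_of_nonneg_right (by linarith) (by linarith)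
      _ ≤ _ := by gcongr
  have hcross : ‖Z‖ ^ 2 * inner ℝ Z R ≤ ‖Y‖ ^ 2 * inner ℝ P c
      + ‖Y‖ ^ 2 * ((a * μ * ‖Y‖ + ‖Y - P‖) * (r * μ))
      + 2 * ‖Y‖ * (a * μ * ‖Y‖ + 2 * ‖Y - P‖) * (‖Y‖ * (r * μ)) := by
    have h1 := mul_le_mul_of_nonneg_left hin (sq_nonneg ‖Y‖)
    have h0 : 0 ≤ ‖Y‖ ^ 2 - ‖Z‖ ^ 2 := by
      have := pow_le_pow_left₀ (norm_nonneg Z) hZY 2; linarith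
    have h2 : (‖Y‖ ^ 2 - ‖Z‖ ^ 2) * (-inner ℝ Z R)
        ≤ (2 * ‖Y‖ * (a * μ * ‖Y‖ + 2 * ‖Y - P‖)) * (‖Y‖ * (r * μ)) :=
      (mul_le_mul_of_nonneg_left habs h0).trans
        (mul_le_mul_of_nonneg_right hsq (by positivity))
    linarith
  have h4 := norm_add_pow_four_le Z R
  have hZ4 : ‖Z‖ ^ 4 ≤ ‖Y‖ ^ 2 * ‖Z‖ ^ 2 := by
    have : ‖Z‖ ^ 2 ≤ ‖Y‖ ^ 2 := by gcongr
    nlinarith [sq_nonneg ‖Z‖]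
  have hZR : ‖Z‖ ^ 2 * ‖R‖ ^ 2 ≤ ‖Y‖ ^ 2 * (r * μ) ^ 2 := by gcongr
  have hR4 : ‖R‖ ^ 4 ≤ (r * μ) ^ 4 := by gcongr
  linarith

/-- When the combination matrix contracts disagreement, a block loses a fixed fraction of the
squared disagreement of its initial vector `Y`, up to second order in `μ`. -/
lemma norm_mix_sq_le_of_near [Nonempty ι] {A : Matrix ι ι ℝ} {c₀ : ℝ} (hc₀ : 0 ≤ c₀)
    (hA : ∀ x : PiLp 2 (fun _ : ι => E),
      ‖mix A x‖ ^ 2 ≤ ‖x‖ ^ 2 - c₀ * ‖x - mix (meanMatrix ι) x‖ ^ 2)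
    {Y X : PiLp 2 (fun _ : ι => E)} {μ a : ℝ} (hXY : ‖X - Y‖ ≤ a * μ * ‖Y‖) :
    ‖mix A X‖ ^ 2 ≤ ‖X‖ ^ 2 - c₀ / 2 * ‖Y - mix (meanMatrix ι) Y‖ ^ 2
      + 4 * c₀ * a ^ 2 * μ ^ 2 * ‖Y‖ ^ 2 := by
  have h1 : ‖Y - mix (meanMatrix ι) Y‖
      ≤ ‖X - mix (meanMatrix ι) X‖ + 2 * (a * μ * ‖Y‖) := by
    have e : Y - mix (meanMatrix ι) Y = (X - mix (meanMatrix ι) X)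
        + (mix (meanMatrix ι) (X - Y) - (X - Y)) := by rw [mix_sub]; abel
    rw [e]
    have h2 := norm_sub_le (mix (meanMatrix ι) (X - Y)) (X - Y)
    have h3 := norm_mix_le (meanMatrix_mem (ι := ι)) (X - Y)
    exact (norm_add_le _ _).trans (by linarith)
  have h2 : ‖Y - mix (meanMatrix ι) Y‖ ^ 2
      ≤ 2 * ‖X - mix (meanMatrix ι) X‖ ^ 2 + 8 * (a * μ * ‖Y‖) ^ 2 := by
    have := pow_le_pow_left₀ (norm_nonneg _) h1 2
    nlinarith [sq_nonneg (‖X - mix (meanMatrix ι) X‖ - 2 * (a * μ * ‖Y‖))]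
  have h3 := mul_le_mul_of_nonneg_left h2 hc₀
  have := hA X
  nlinarith

/-- The terms left after averaging the pathwise bound combine to a contraction of the fourth
power: the gain from the disagreement `z` and the strong convexity of the risks absorb every
term of the wrong sign up to an error of order `μ ^ 3`. -/
lemma fourth_moment_absorb {p ν c₀ : ℝ} (hp : 0 < p) (hν : 0 < ν) (hc₀ : 0 < c₀) (a b r : ℝ) :
    ∃ μ₁ > 0, ∃ C > 0, ∀ μ, 0 < μ → μ < μ₁ → ∀ y z : ℝ,
      y ^ 4 - p * (μ * ν * y ^ 4) - p * (y ^ 2 * (c₀ / 2 * z ^ 2 - 4 * c₀ * a ^ 2 * μ ^ 2 * y ^ 2))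
        + y ^ 2 * (b * μ ^ 2 * y + 20 * r * μ * z + 8 * r ^ 2 * μ ^ 2) + 3 * r ^ 4 * μ ^ 4
      ≤ (1 - p * ν / 2 * μ) * y ^ 4 + C * μ ^ 3 := by
  set c₁ := 200 * r ^ 2 / (p * c₀) + 2 * b ^ 2 / (p * ν) + 8 * r ^ 2 with hc₁
  refine ⟨min 1 (ν / (32 * c₀ * a ^ 2 + 1)), by positivity,
    c₁ ^ 2 / (p * ν) + 3 * r ^ 4 + 1, by positivity, fun μ hμ hμ₁ y z => ?_⟩
  have hμ1 : μ ≤ 1 := hμ₁.le.trans (min_le_left _ _)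
  have hμ2 : μ * (32 * c₀ * a ^ 2 + 1) ≤ ν :=
    (le_div_iff₀ (by positivity)).1 (hμ₁.le.trans (min_le_right _ _))
  have hpν : 0 < p * ν := by positivity
  have hpc : 0 < p * c₀ := by positivity
  have e1 : 20 * r * μ * z ≤ p * c₀ / 2 * z ^ 2 + 200 * r ^ 2 / (p * c₀) * μ ^ 2 := by
    have : p * c₀ / 2 * z ^ 2 + 200 * r ^ 2 / (p * c₀) * μ ^ 2 - 20 * r * μ * z
        = (p * c₀ * z - 20 * r * μ) ^ 2 / (2 * (p * c₀)) := by field_simp; ring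
    have : 0 ≤ (p * c₀ * z - 20 * r * μ) ^ 2 / (2 * (p * c₀)) := by positivity
    linarith
  have e2 : b * μ ^ 2 * y ≤ p * ν / 8 * μ * y ^ 2 + 2 * b ^ 2 / (p * ν) * μ ^ 2 := by
    have h : p * ν / 8 * μ * y ^ 2 + 2 * b ^ 2 / (p * ν) * μ ^ 3 - b * μ ^ 2 * y
        = μ * (p * ν * y - 4 * b * μ) ^ 2 / (8 * (p * ν)) := by field_simp; ring
    have h' : 0 ≤ μ * (p * ν * y - 4 * b * μ) ^ 2 / (8 * (p * ν)) := by positivity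
    have h'' : 2 * b ^ 2 / (p * ν) * μ ^ 3 ≤ 2 * b ^ 2 / (p * ν) * μ ^ 2 := by
      have := pow_le_pow_of_le_one hμ.le hμ1 (show 2 ≤ 3 by norm_num)
      gcongr
    linarith
  have e3 : 4 * p * c₀ * a ^ 2 * μ ^ 2 * y ^ 2 ≤ p * ν / 8 * μ * y ^ 2 := by
    have : 32 * c₀ * a ^ 2 * μ ≤ ν := by nlinarith
    have := mul_le_mul_of_nonneg_left this (show 0 ≤ p / 8 * μ * y ^ 2 by positivity)
    linarith
  have e4 : y ^ 2 * (c₁ * μ ^ 2) ≤ p * ν / 4 * μ * y ^ 4 + c₁ ^ 2 / (p * ν) * μ ^ 3 := by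
    have : p * ν / 4 * μ * y ^ 4 + c₁ ^ 2 / (p * ν) * μ ^ 3 - y ^ 2 * (c₁ * μ ^ 2)
        = μ * (p * ν * y ^ 2 - 2 * c₁ * μ) ^ 2 / (4 * (p * ν)) := by field_simp; ring
    have : 0 ≤ μ * (p * ν * y ^ 2 - 2 * c₁ * μ) ^ 2 / (4 * (p * ν)) := by positivity
    linarith
  have e5 : 3 * r ^ 4 * μ ^ 4 ≤ 3 * r ^ 4 * μ ^ 3 := by
    have := pow_le_pow_of_le_one hμ.le hμ1 (show 3 ≤ 4 by norm_num)
    gcongr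
  have e6 := mul_le_mul_of_nonneg_left (add_le_add (add_le_add e1 e2) e3) (sq_nonneg y)
  have e7 : 0 < μ ^ 3 := by positivity
  have e8 : y ^ 2 * (c₁ * μ ^ 2) = y ^ 2 * (200 * r ^ 2 / (p * c₀) * μ ^ 2)
      + y ^ 2 * (2 * b ^ 2 / (p * ν) * μ ^ 2) + y ^ 2 * (8 * r ^ 2 * μ ^ 2) := by
    rw [hc₁]; ring
  nlinarith

end Drift

/-! ### The risks and their Hessians at the minimizer -/

namespace Setup

variable {K M : ℕ} {𝒳 : Type*} {S : Setup K M 𝒳} {ν δ : ℝ}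

lemma RiskAndLoss.mono (h : S.RiskAndLoss ν δ) {δ' : ℝ} (hδ : δ ≤ δ') : S.RiskAndLoss ν δ' where
  twiceDifferentiable := h.twiceDifferentiable
  stronglyConvex := h.stronglyConvex
  convex := h.convex
  lipschitzGradient k n w₁ w₂ := (h.lipschitzGradient k n w₁ w₂).trans (by gcongr)

lemma RiskAndLoss.norm_lossStep_sub_le (h : S.RiskAndLoss ν δ) (hδ : 0 < δ) {s : ℝ} (hs : 0 ≤ s)
    (hsδ : s * δ ≤ 1) (k : Fin K) (n : Fin (S.N k)) (x y : EuclideanSpace ℝ (Fin M)) :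
    ‖(y - s • S.lossGrad k n y) - (x - s • S.lossGrad k n x)‖ ≤ ‖y - x‖ :=
  norm_gradientStep_sub_le hδ (h.convex k n) (h.lipschitzGradient k n) hs hsδ x y

lemma RiskAndLoss.hasGradientAt_risk (h : S.RiskAndLoss ν δ) (k : Fin K)
    (w : EuclideanSpace ℝ (Fin M)) :
    HasGradientAt (S.risk k) ((1 / (S.N k : ℝ)) • ∑ n, S.lossGrad k n w) w := by
  rw [hasGradientAt_iff_hasFDerivAt]
  have h1 : ∀ n, HasFDerivAt (fun v => S.loss k v (S.data k n))
      (InnerProductSpace.toDual ℝ _ (S.lossGrad k n w)) w := fun n =>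
    hasGradientAt_iff_hasFDerivAt.1 ((h.twiceDifferentiable k n).1 w).hasGradientAt
  have h2 := (HasFDerivAt.fun_sum fun n (_ : n ∈ Finset.univ) => h1 n).const_smul
    (1 / (S.N k : ℝ))
  rw [map_smulₛₗ, map_sum]
  exact h2

lemma RiskAndLoss.riskGrad_eq (h : S.RiskAndLoss ν δ) (k : Fin K)
    (w : EuclideanSpace ℝ (Fin M)) :
    S.riskGrad k w = (1 / (S.N k : ℝ)) • ∑ n, S.lossGrad k n w :=
  (h.hasGradientAt_risk k w).gradient

lemma N_cast_pos (S : Setup K M 𝒳) (k : Fin K) : (0 : ℝ) < S.N k := by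
  exact_mod_cast S.N_pos k

lemma RiskAndLoss.differentiable_riskGrad (h : S.RiskAndLoss ν δ) (k : Fin K) :
    Differentiable ℝ (S.riskGrad k) := by
  have : S.riskGrad k = fun w => (1 / (S.N k : ℝ)) • ∑ n, S.lossGrad k n w :=
    funext (h.riskGrad_eq k)
  rw [this]
  have h1 : Differentiable ℝ fun w => ∑ n, S.lossGrad k n w :=
    Differentiable.fun_sum fun n _ => (h.twiceDifferentiable k n).2
  exact h1.const_smul (1 / (S.N k : ℝ))

lemma RiskAndLoss.norm_riskGrad_sub_le (h : S.RiskAndLoss ν δ) (k : Fin K)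
    (x y : EuclideanSpace ℝ (Fin M)) :
    ‖S.riskGrad k y - S.riskGrad k x‖ ≤ δ * ‖y - x‖ := by
  have hN := S.N_cast_pos k
  rw [h.riskGrad_eq, h.riskGrad_eq, ← smul_sub, ← Finset.sum_sub_distrib, norm_smul,
    Real.norm_eq_abs, abs_of_pos (by positivity), one_div, inv_mul_le_iff₀ hN]
  refine (norm_sum_le _ _).trans
    ((Finset.sum_le_sum fun n _ => h.lipschitzGradient k n x y).trans ?_)
  simp

lemma RiskAndLoss.inner_riskGrad_sub_ge (h : S.RiskAndLoss ν δ) (k : Fin K)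
    (x y : EuclideanSpace ℝ (Fin M)) :
    ν * ‖y - x‖ ^ 2 ≤ inner ℝ (S.riskGrad k y - S.riskGrad k x) (y - x) := by
  have h1 := h.stronglyConvex k x y
  have h2 := h.stronglyConvex k y x
  have h3 : inner ℝ (S.riskGrad k y) (x - y) = - inner ℝ (S.riskGrad k y) (y - x) := by
    rw [← inner_neg_right, neg_sub]
  rw [norm_sub_rev x y] at h2
  rw [inner_sub_left]
  linarith

lemma RiskAndLoss.norm_riskHess_le (h : S.RiskAndLoss ν δ) (hδ : 0 ≤ δ) (k : Fin K)
    (w y : EuclideanSpace ℝ (Fin M)) : ‖S.riskHess k w y‖ ≤ δ * ‖y‖ := by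
  have h1 : ‖S.riskHess k w‖ ≤ (⟨δ, hδ⟩ : NNReal) := by
    refine norm_fderiv_le_of_lipschitz ℝ (LipschitzWith.of_dist_le_mul fun x y => ?_)
    rw [dist_eq_norm, dist_eq_norm]
    exact h.norm_riskGrad_sub_le k y x
  exact ContinuousLinearMap.le_of_opNorm_le _ h1 y

lemma RiskAndLoss.inner_riskHess_ge (h : S.RiskAndLoss ν δ) (k : Fin K)
    (w y : EuclideanSpace ℝ (Fin M)) : ν * ‖y‖ ^ 2 ≤ inner ℝ (S.riskHess k w y) y := by
  have hd : HasFDerivAt (S.riskGrad k) (S.riskHess k w) w :=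
    (h.differentiable_riskGrad k w).hasFDerivAt
  have h1 : HasDerivAt (fun t : ℝ => inner ℝ (S.riskGrad k (w + t • y)) y)
      (inner ℝ (S.riskHess k w y) y) 0 := by
    have hline : HasDerivAt (fun t : ℝ => w + t • y) y 0 := by
      simpa using ((hasDerivAt_id (0 : ℝ)).smul_const y).const_add w
    have hd' : HasFDerivAt (S.riskGrad k) (S.riskHess k w) (w + (0 : ℝ) • y) := by simpa using hd
    have h2 := hd'.comp_hasDerivAt (0 : ℝ) hline
    simpa using h2.inner ℝ (hasDerivAt_const (0 : ℝ) y)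
  have h2 := h1.tendsto_slope_zero_right
  refine ge_of_tendsto h2 ?_
  filter_upwards [self_mem_nhdsWithin] with t (ht : 0 < t)
  have h3 := h.inner_riskGrad_sub_ge k w (w + t • y)
  simp only [add_sub_cancel_left, norm_smul, inner_smul_right, Real.norm_eq_abs, mul_pow,
    sq_abs] at h3
  simp only [zero_add, zero_smul, add_zero, smul_eq_mul, ← inner_sub_left]
  rw [inv_mul_eq_div, le_div_iff₀ ht]
  refine le_of_mul_le_mul_left ?_ ht
  linarith

lemma RiskAndLoss.norm_sub_smul_riskHess_le (h : S.RiskAndLoss ν δ) (hδ : 0 ≤ δ) {μ : ℝ}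
    (hμ : 0 ≤ μ) (hμδ : μ * δ ^ 2 ≤ ν) (hμν : μ * ν ≤ 1) (k : Fin K)
    (w y : EuclideanSpace ℝ (Fin M)) :
    ‖y - μ • S.riskHess k w y‖ ≤ (1 - μ * ν / 2) * ‖y‖ := by
  have h1 := h.norm_riskHess_le hδ k w y
  have h2 := h.inner_riskHess_ge k w y
  have h3 : ‖S.riskHess k w y‖ ^ 2 ≤ δ ^ 2 * ‖y‖ ^ 2 := by rw [← mul_pow]; gcongr
  refine le_of_sq_le_sq ?_ (mul_nonneg (by linarith) (norm_nonneg _))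
  rw [norm_sub_sq_real, inner_smul_right, real_inner_comm, norm_smul, mul_pow, mul_pow,
    Real.norm_eq_abs, sq_abs]
  have h4 : μ ^ 2 * ‖S.riskHess k w y‖ ^ 2 ≤ μ * ν * ‖y‖ ^ 2 := by
    calc μ ^ 2 * ‖S.riskHess k w y‖ ^ 2 ≤ μ ^ 2 * (δ ^ 2 * ‖y‖ ^ 2) := by gcongr
      _ = μ * (μ * δ ^ 2) * ‖y‖ ^ 2 := by ring
      _ ≤ _ := by gcongr
  have h5 := mul_le_mul_of_nonneg_left h2 hμ
  nlinarith [sq_nonneg (μ * ν * ‖y‖)]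

/-- The gradient of the risk differs from its linearization at `wo` by a quadratic error, also
far from `wo`, where the Lipschitz condition on the Hessians gives nothing but the gradients grow
at most linearly. -/
lemma RiskAndLoss.exists_norm_riskGrad_sub_le (h : S.RiskAndLoss ν δ) (hδ : 0 ≤ δ)
    {wo : EuclideanSpace ℝ (Fin M)} (hH : S.SmoothHessians wo) :
    ∃ C > 0, ∀ k y, ‖S.riskGrad k (wo + y) - S.riskGrad k wo - S.riskHess k wo y‖
      ≤ C * ‖y‖ ^ 2 := by
  obtain ⟨κ, hκ, ε, hε, hHess⟩ := hH
  refine ⟨κ + 2 * δ / ε, by positivity, fun k y => ?_⟩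
  by_cases hy : ‖y‖ ≤ ε
  · have hmv := (convex_closedBall wo ‖y‖).norm_image_sub_le_of_norm_hasFDerivWithin_le
      (f := fun v => S.riskGrad k v - S.riskHess k wo v)
      (f' := fun v => S.riskHess k v - S.riskHess k wo) (C := κ * ‖y‖) (x := wo) (y := wo + y)
      (fun v _ => (((h.differentiable_riskGrad k v).hasFDerivAt).sub
        (S.riskHess k wo).hasFDerivAt).hasFDerivWithinAt)
      (fun v hv => by
        rw [mem_closedBall_iff_norm] at hv
        have := hHess k (v - wo) (hv.trans hy)
        rw [add_sub_cancel] at this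
        refine this.trans ?_
        gcongr)
      (Metric.mem_closedBall_self (norm_nonneg _)) (by simp)
    have e : S.riskGrad k (wo + y) - S.riskHess k wo (wo + y)
        - (S.riskGrad k wo - S.riskHess k wo wo)
        = S.riskGrad k (wo + y) - S.riskGrad k wo - S.riskHess k wo y := by
      rw [map_add]; abel
    rw [e, add_sub_cancel_left] at hmv
    have : 0 ≤ 2 * δ / ε * ‖y‖ ^ 2 := by positivity
    nlinarith
  · push Not at hy
    have h1 := h.norm_riskGrad_sub_le k wo (wo + y)
    rw [add_sub_cancel_left] at h1
    have h2 := h.norm_riskHess_le hδ k wo y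
    have h3 : 2 * δ * ‖y‖ ≤ 2 * δ / ε * ‖y‖ ^ 2 := by
      rw [div_mul_eq_mul_div, le_div_iff₀ hε]
      have := mul_le_mul_of_nonneg_left hy.le (show 0 ≤ 2 * δ * ‖y‖ by positivity)
      nlinarith
    have h4 : 0 ≤ κ * ‖y‖ ^ 2 := by positivity
    calc _ ≤ _ := norm_sub_le _ _
      _ ≤ _ := by linarith

/-- Averaged over the dataset, one stochastic gradient step from `wo + y` and one from `wo`, with
the same data point, contract the squared distance. -/
lemma RiskAndLoss.mean_norm_lossStep_sq_le (h : S.RiskAndLoss ν δ) {μ : ℝ}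
    (hμ : 0 ≤ μ) (hμδ : μ * δ ^ 2 ≤ ν) (k : Fin K) (wo y : EuclideanSpace ℝ (Fin M)) :
    (1 / (S.N k : ℝ)) * ∑ n, ‖y - μ • (S.lossGrad k n (wo + y) - S.lossGrad k n wo)‖ ^ 2
      ≤ (1 - μ * ν) * ‖y‖ ^ 2 := by
  have hN := S.N_cast_pos k
  have h1 : ∀ n, ‖y - μ • (S.lossGrad k n (wo + y) - S.lossGrad k n wo)‖ ^ 2
      ≤ ‖y‖ ^ 2 - 2 * μ * inner ℝ (S.lossGrad k n (wo + y) - S.lossGrad k n wo) y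
        + μ * ν * ‖y‖ ^ 2 := by
    intro n
    rw [norm_sub_sq_real, inner_smul_right, norm_smul, mul_pow, Real.norm_eq_abs, sq_abs,
      real_inner_comm]
    have h2 := h.lipschitzGradient k n wo (wo + y)
    rw [add_sub_cancel_left] at h2
    have h3 := pow_le_pow_left₀ (norm_nonneg _) h2 2
    have h4 : μ ^ 2 * ‖S.lossGrad k n (wo + y) - S.lossGrad k n wo‖ ^ 2
        ≤ μ * (μ * δ ^ 2) * ‖y‖ ^ 2 := by nlinarith [mul_le_mul_of_nonneg_left h3 (sq_nonneg μ)]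
    have h5 : μ * (μ * δ ^ 2) * ‖y‖ ^ 2 ≤ μ * ν * ‖y‖ ^ 2 := by gcongr
    linarith
  have h6 := h.inner_riskGrad_sub_ge k wo (wo + y)
  rw [add_sub_cancel_left, h.riskGrad_eq, h.riskGrad_eq, ← smul_sub, ← Finset.sum_sub_distrib,
    real_inner_smul_left, sum_inner] at h6
  have h7 := Finset.sum_le_sum fun n (_ : n ∈ Finset.univ) => h1 n
  rw [Finset.sum_add_distrib, Finset.sum_sub_distrib, ← Finset.mul_sum] at h7
  simp only [Finset.sum_const, Finset.card_univ, Fintype.card_fin, nsmul_eq_mul] at h7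
  have h8 := mul_le_mul_of_nonneg_left h7 (show 0 ≤ 1 / (S.N k : ℝ) by positivity)
  have h9 := mul_le_mul_of_nonneg_left h6 hμ
  refine h8.trans ?_
  have e : ∀ a b c : ℝ, 1 / (S.N k : ℝ) * (S.N k * a - 2 * μ * b + S.N k * c)
      = a - 2 * (μ * (1 / (S.N k : ℝ) * b)) + c := by
    intro a b c; field_simp
  rw [e]
  linarith

lemma RiskAndLoss.sum_smul_riskGrad_eq_zero (h : S.RiskAndLoss ν δ) (hK : 0 < K)
    {wo : EuclideanSpace ℝ (Fin M)} (hwo : IsMinOn S.weightedRisk Set.univ wo) :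
    ∑ k, S.q k • S.riskGrad k wo = 0 := by
  have h1 : ∀ k, HasFDerivAt (S.risk k) (InnerProductSpace.toDual ℝ _ (S.riskGrad k wo)) wo := by
    intro k
    rw [h.riskGrad_eq]
    exact hasGradientAt_iff_hasFDerivAt.1 (h.hasGradientAt_risk k wo)
  have h2 : HasFDerivAt S.weightedRisk ((1 / (K : ℝ)) •
      ∑ k, S.q k • InnerProductSpace.toDual ℝ _ (S.riskGrad k wo)) wo := by
    have := (HasFDerivAt.fun_sum fun k (_ : k ∈ Finset.univ) =>
      (h1 k).const_smul (S.q k)).const_smul (1 / (K : ℝ))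
    exact this
  have h3 := (hwo.isLocalMin Filter.univ_mem).hasFDerivAt_eq_zero h2
  have hK' : (1 / (K : ℝ)) ≠ 0 := by positivity
  have h4 := (smul_eq_zero.1 h3).resolve_left hK'
  apply (InnerProductSpace.toDual ℝ (EuclideanSpace ℝ (Fin M))).injective
  rw [map_zero, map_sum, ← h4]
  exact Finset.sum_congr rfl fun k _ => by rw [map_smulₛₗ]; rfl

lemma exists_norm_lossGrad_le (S : Setup K M 𝒳) (wo : EuclideanSpace ℝ (Fin M)) :
    ∃ G, 0 ≤ G ∧ ∀ k n, ‖S.lossGrad k n wo‖ ≤ G := by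
  refine ⟨∑ k, ∑ n, ‖S.lossGrad k n wo‖, by positivity, fun k n => ?_⟩
  refine (Finset.single_le_sum (f := fun n => ‖S.lossGrad k n wo‖)
    (fun _ _ => norm_nonneg _) (Finset.mem_univ n)).trans ?_
  exact Finset.single_le_sum (f := fun k => ∑ n, ‖S.lossGrad k n wo‖)
    (fun _ _ => Finset.sum_nonneg fun _ _ => norm_nonneg _) (Finset.mem_univ k)

/-! ### The combination matrices -/

lemma CombinationMatrix.mem_doublyStochastic (hA : S.CombinationMatrix) :
    S.A ∈ doublyStochastic ℝ (Fin K) := by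
  rw [mem_doublyStochastic_iff_sum]
  refine ⟨hA.nonneg, fun i => ?_, hA.leftStochastic⟩
  rw [← hA.leftStochastic i]
  exact Finset.sum_congr rfl fun j _ => hA.symm i j

lemma CombinationMatrix.activeMatrix_symm (hA : S.CombinationMatrix) (α : Fin K → Bool)
    (ℓ k : Fin K) : S.activeMatrix α ℓ k = S.activeMatrix α k ℓ := by
  unfold activeMatrix
  by_cases h : ℓ = k
  · subst h; rfl
  · rw [if_neg h, if_neg (Ne.symm h), hA.symm ℓ k]
    simp only [and_comm]

lemma sum_activeMatrix (S : Setup K M 𝒳) (α : Fin K → Bool) (k : Fin K) :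
    ∑ ℓ, S.activeMatrix α ℓ k = 1 := by
  rw [← Finset.add_sum_erase _ _ (Finset.mem_univ k)]
  have h1 : ∀ ℓ ∈ Finset.univ.erase k, S.activeMatrix α ℓ k
      = if α k = true ∧ α ℓ = true then S.A ℓ k else 0 := by
    intro ℓ hℓ
    rw [activeMatrix, if_neg (Finset.ne_of_mem_erase hℓ)]
  rw [Finset.sum_congr rfl h1, activeMatrix, if_pos rfl]
  by_cases hk : α k = true
  · simp only [hk, if_true, true_and]
    rw [← Finset.sum_filter]
    have : Finset.filter (fun ℓ => α ℓ = true) (Finset.univ.erase k)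
        = Finset.univ.filter fun j => j ≠ k ∧ α j = true := by
      ext j; simp
    rw [this]; ring
  · simp [hk]

lemma CombinationMatrix.activeMatrix_mem (hA : S.CombinationMatrix) (α : Fin K → Bool) :
    S.activeMatrix α ∈ doublyStochastic ℝ (Fin K) := by
  rw [mem_doublyStochastic_iff_sum]
  refine ⟨fun ℓ k => ?_, fun i => ?_, S.sum_activeMatrix α⟩
  · unfold activeMatrix
    split_ifs with h1 h2 h3
    · rw [sub_nonneg, ← hA.leftStochastic k]
      exact Finset.sum_le_sum_of_subset_of_nonneg (Finset.subset_univ _)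
        fun j _ _ => hA.nonneg j k
    · exact zero_le_one
    · exact hA.nonneg ℓ k
    · exact le_rfl
  · rw [← S.sum_activeMatrix α i]
    exact Finset.sum_congr rfl fun j _ => hA.activeMatrix_symm α i j

lemma CombinationMatrix.activeMatrix_of_forall (hA : S.CombinationMatrix) {α : Fin K → Bool}
    (hα : ∀ k, α k = true) : S.activeMatrix α = S.A := by
  ext ℓ k
  by_cases h : ℓ = k
  · subst h
    have h1 := hA.leftStochastic ℓ
    rw [← Finset.add_sum_erase _ _ (Finset.mem_univ ℓ)] at h1
    have h2 : (Finset.univ.filter fun j => j ≠ ℓ ∧ α j = true) = Finset.univ.erase ℓ := by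
      ext j; simp [hα]
    rw [activeMatrix, if_pos rfl, if_pos (hα ℓ), h2]
    linarith
  · simp [activeMatrix, h, hα]

end Setup

namespace Setup

variable {K M : ℕ} {𝒳 : Type*} {S : Setup K M 𝒳} {ν δ : ℝ}

/-! ### Pathwise analysis of a block -/

/-- The deviation `col{w_{k,n} - wo}` of the models from `wo`, with the Euclidean norm. -/
noncomputable def deviation (S : Setup K M 𝒳) (wo : EuclideanSpace ℝ (Fin M)) (μ : ℝ)
    (act : ℕ → Fin K → Bool) (ξ : ℕ → (k : Fin K) → Fin (S.N k)) (n : ℕ) :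
    PiLp 2 (fun _ : Fin K => EuclideanSpace ℝ (Fin M)) :=
  WithLp.toLp 2 fun k => S.model μ act ξ n k - wo

/-- The `t`-th stochastic gradient field of agent `k` in block `i`. -/
noncomputable def blockGrad (S : Setup K M 𝒳) (ξ : ℕ → (k : Fin K) → Fin (S.N k)) (i : ℕ)
    (k : Fin K) (t : ℕ) : EuclideanSpace ℝ (Fin M) → EuclideanSpace ℝ (Fin M) :=
  S.lossGrad k (ξ (i * S.T + t + 1) k)

/-- The difference of the local trajectories of block `i` that start at the models and at `wo`,
with the same data points, after `t` steps. -/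
noncomputable def blockGap (S : Setup K M 𝒳) (wo : EuclideanSpace ℝ (Fin M)) (μ : ℝ)
    (act : ℕ → Fin K → Bool) (ξ : ℕ → (k : Fin K) → Fin (S.N k)) (i t : ℕ) :
    PiLp 2 (fun _ : Fin K => EuclideanSpace ℝ (Fin M)) :=
  WithLp.toLp 2 fun k =>
    localDescent (if act i k then μ else 0) (S.blockGrad ξ i k) (S.model μ act ξ (i * S.T) k) t
      - localDescent (if act i k then μ else 0) (S.blockGrad ξ i k) wo t

/-- The displacement of the local trajectories of block `i` that start at `wo`, after `t` steps. -/
noncomputable def blockShift (S : Setup K M 𝒳) (wo : EuclideanSpace ℝ (Fin M)) (μ : ℝ)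
    (act : ℕ → Fin K → Bool) (ξ : ℕ → (k : Fin K) → Fin (S.N k)) (i t : ℕ) :
    PiLp 2 (fun _ : Fin K => EuclideanSpace ℝ (Fin M)) :=
  WithLp.toLp 2 fun k =>
    localDescent (if act i k then μ else 0) (S.blockGrad ξ i k) wo t - wo

variable {wo : EuclideanSpace ℝ (Fin M)} {μ : ℝ} {act : ℕ → Fin K → Bool}
  {ξ : ℕ → (k : Fin K) → Fin (S.N k)}

lemma block_div {t : ℕ} (i : ℕ) (ht : t < S.T) : (i * S.T + t) / S.T = i := by
  rw [mul_comm, Nat.mul_add_div (by omega), Nat.div_eq_of_lt ht, add_zero]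

lemma block_mod {t : ℕ} (i : ℕ) (ht : t < S.T) : (i * S.T + t) % S.T = t := by
  rw [mul_comm, Nat.mul_add_mod, Nat.mod_eq_of_lt ht]

lemma model_block (i : ℕ) {t : ℕ} (ht : t < S.T) (k : Fin K) :
    S.model μ act ξ (i * S.T + t) k
      = localDescent (if act i k then μ else 0) (S.blockGrad ξ i k)
          (S.model μ act ξ (i * S.T) k) t := by
  induction t generalizing k with
  | zero => rfl
  | succ t ih =>
    have ht' : t < S.T := by omega
    rw [← add_assoc, model, stepMatrix, block_mod i ht', if_neg (by omega)]
    refine (congrArg (fun x => x k) (mix_one (WithLp.toLp 2 fun ℓ =>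
      S.model μ act ξ (i * S.T + t) ℓ - S.stepSize μ act (i * S.T + t) ℓ •
        S.lossGrad ℓ (ξ (i * S.T + t + 1) ℓ) (S.model μ act ξ (i * S.T + t) ℓ)))).trans ?_
    simp only [stepSize, block_div i ht', ih ht']
    rfl

lemma model_block_end (hT : 0 < S.T) (i : ℕ) (k : Fin K) :
    S.model μ act ξ ((i + 1) * S.T) k
      = ∑ ℓ, S.activeMatrix (act i) ℓ k •
          localDescent (if act i ℓ then μ else 0) (S.blockGrad ξ i ℓ)
            (S.model μ act ξ (i * S.T) ℓ) S.T := by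
  obtain ⟨t, ht⟩ : ∃ t, S.T = t + 1 := ⟨S.T - 1, by omega⟩
  have ht' : t < S.T := by omega
  have e : (i + 1) * S.T = i * S.T + t + 1 := by rw [add_mul, one_mul]; omega
  have e2 : ∀ (s : ℝ) (g : ℕ → EuclideanSpace ℝ (Fin M) → EuclideanSpace ℝ (Fin M)) x,
      localDescent s g x S.T = localDescent s g x t - s • g t (localDescent s g x t) := by
    intro s g x; rw [ht]; rfl
  rw [e, model, stepMatrix, block_mod i ht', if_pos (by omega)]
  simp only [stepSize, block_div i ht', model_block i ht', e2]
  rfl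

lemma deviation_block (i : ℕ) {t : ℕ} (ht : t < S.T) :
    S.deviation wo μ act ξ (i * S.T + t)
      = S.blockGap wo μ act ξ i t + S.blockShift wo μ act ξ i t := by
  ext1 k
  simp only [deviation, blockGap, blockShift, PiLp.add_apply, model_block i ht]
  abel

lemma deviation_block_end (hT : 0 < S.T) (i : ℕ) :
    S.deviation wo μ act ξ ((i + 1) * S.T)
      = mix (S.activeMatrix (act i)) (S.blockGap wo μ act ξ i S.T)
        + mix (S.activeMatrix (act i)) (S.blockShift wo μ act ξ i S.T) := by
  rw [← mix_add]
  ext1 k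
  have h1 : wo = ∑ ℓ, S.activeMatrix (act i) ℓ k • wo := by
    rw [← Finset.sum_smul, S.sum_activeMatrix, one_smul]
  simp only [deviation, mix_apply, model_block_end hT]
  conv_lhs => rw [h1]
  rw [← Finset.sum_sub_distrib]
  refine Finset.sum_congr rfl fun ℓ _ => ?_
  rw [← smul_sub]
  simp only [blockGap, blockShift, PiLp.add_apply]
  congr 1
  abel

lemma norm_le_mul_norm_of_forall {x y : PiLp 2 (fun _ : Fin K => EuclideanSpace ℝ (Fin M))}
    {C : ℝ} (hC : 0 ≤ C) (h : ∀ k, ‖x k‖ ≤ C * ‖y k‖) : ‖x‖ ≤ C * ‖y‖ := by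
  refine le_of_sq_le_sq ?_ (by positivity)
  rw [mul_pow, PiLp.norm_sq_eq_of_L2, PiLp.norm_sq_eq_of_L2, Finset.mul_sum]
  refine Finset.sum_le_sum fun k _ => ?_
  rw [← mul_pow]
  exact pow_le_pow_left₀ (norm_nonneg _) (h k) 2

lemma norm_le_card_mul_of_forall {x : PiLp 2 (fun _ : Fin K => EuclideanSpace ℝ (Fin M))}
    {C : ℝ} (hC : 0 ≤ C) (h : ∀ k, ‖x k‖ ≤ C) : ‖x‖ ≤ K * C := by
  refine le_of_sq_le_sq ?_ (by positivity)
  rw [mul_pow, PiLp.norm_sq_eq_of_L2]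
  have h1 : ∑ k, ‖x k‖ ^ 2 ≤ ∑ _k : Fin K, C ^ 2 :=
    Finset.sum_le_sum fun k _ => pow_le_pow_left₀ (norm_nonneg _) (h k) 2
  rw [Finset.sum_const, Finset.card_univ, Fintype.card_fin, nsmul_eq_mul] at h1
  refine h1.trans ?_
  have : (K : ℝ) ≤ (K : ℝ) ^ 2 := by exact_mod_cast Nat.le_self_pow two_ne_zero K
  gcongr

lemma ite_step_nonneg (hμ : 0 ≤ μ) (b : Bool) : 0 ≤ (if b then μ else 0 : ℝ) := by
  split_ifs <;> simp [hμ]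

lemma ite_step_le (hμ : 0 ≤ μ) (b : Bool) : (if b then μ else 0 : ℝ) ≤ μ := by
  split_ifs <;> simp [hμ]

section

variable (h : S.RiskAndLoss ν δ) (hδ : 0 < δ) (hμ : 0 ≤ μ) (hμδ : μ * δ ≤ 1)
include h hδ hμ hμδ

lemma RiskAndLoss.norm_blockStep_sub_le (i : ℕ) (k : Fin K) (t : ℕ)
    (x y : EuclideanSpace ℝ (Fin M)) :
    ‖(y - (if act i k then μ else 0 : ℝ) • S.blockGrad ξ i k t y)
      - (x - (if act i k then μ else 0 : ℝ) • S.blockGrad ξ i k t x)‖ ≤ ‖y - x‖ :=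
  h.norm_lossStep_sub_le hδ (ite_step_nonneg hμ _)
    ((mul_le_mul_of_nonneg_right (ite_step_le hμ _) hδ.le).trans hμδ) k _ x y

lemma RiskAndLoss.norm_blockGap_le (i t : ℕ) :
    ‖S.blockGap wo μ act ξ i t‖ ≤ ‖S.deviation wo μ act ξ (i * S.T)‖ := by
  rw [← one_mul ‖S.deviation wo μ act ξ (i * S.T)‖]
  refine norm_le_mul_norm_of_forall zero_le_one fun k => ?_
  rw [one_mul]
  exact norm_localDescent_sub_le (h.norm_blockStep_sub_le hδ hμ hμδ i k) _ _ t

lemma RiskAndLoss.norm_blockGap_sub_le (i t : ℕ) :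
    ‖S.blockGap wo μ act ξ i t - S.deviation wo μ act ξ (i * S.T)‖
      ≤ t * δ * μ * ‖S.deviation wo μ act ξ (i * S.T)‖ := by
  refine norm_le_mul_norm_of_forall (by positivity) fun k => ?_
  refine (norm_localDescent_sub_sub_le (ite_step_nonneg hμ (act i k)) hδ.le
    (h.norm_blockStep_sub_le hδ hμ hμδ i k) (fun t => h.lipschitzGradient k _) wo
    (S.model μ act ξ (i * S.T) k) t).trans ?_
  have := ite_step_le hμ (act i k)
  calc (t : ℝ) * ((if act i k then μ else 0) * δ * ‖S.model μ act ξ (i * S.T) k - wo‖)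
      ≤ t * (μ * δ * ‖S.model μ act ξ (i * S.T) k - wo‖) := by gcongr
    _ = t * δ * μ * ‖S.deviation wo μ act ξ (i * S.T) k‖ := by simp only [deviation]; ring

lemma RiskAndLoss.norm_blockShift_le {G : ℝ} (hG0 : 0 ≤ G)
    (hG : ∀ k n, ‖S.lossGrad k n wo‖ ≤ G) (i t : ℕ) :
    ‖S.blockShift wo μ act ξ i t‖ ≤ K * t * G * μ := by
  have h1 : ∀ k, ‖S.blockShift wo μ act ξ i t k‖ ≤ t * (μ * G) := fun k =>
    (norm_localDescent_sub_self_le (ite_step_nonneg hμ (act i k))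
      (h.norm_blockStep_sub_le hδ hμ hμδ i k) (fun t => hG k _) t).trans
      (by have := ite_step_le hμ (act i k); gcongr)
  refine (norm_le_card_mul_of_forall (by positivity) h1).trans (le_of_eq (by ring))

lemma RiskAndLoss.norm_blockShift_add_le {G : ℝ} (hG0 : 0 ≤ G)
    (hG : ∀ k n, ‖S.lossGrad k n wo‖ ≤ G) (i t : ℕ) :
    ‖S.blockShift wo μ act ξ i t + WithLp.toLp 2 fun k => (if act i k then μ else 0 : ℝ) •
        ∑ j ∈ Finset.range t, S.blockGrad ξ i k j wo‖ ≤ K * t ^ 2 * δ * G * μ ^ 2 := by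
  have h1 : ∀ k, ‖(S.blockShift wo μ act ξ i t + WithLp.toLp 2 fun k =>
      (if act i k then μ else 0 : ℝ) • ∑ j ∈ Finset.range t, S.blockGrad ξ i k j wo :
      PiLp 2 (fun _ : Fin K => EuclideanSpace ℝ (Fin M))) k‖
      ≤ t ^ 2 * (δ * G * μ ^ 2) := fun k =>
    (norm_localDescent_sub_self_add_le (ite_step_nonneg hμ (act i k)) hδ.le hG0
      (h.norm_blockStep_sub_le hδ hμ hμδ i k) (fun t => h.lipschitzGradient k _)
      (fun t => hG k _) t).trans
      (by
        have := ite_step_le hμ (act i k)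
        have := ite_step_nonneg hμ (act i k)
        gcongr)
  refine (norm_le_card_mul_of_forall (by positivity) h1).trans (le_of_eq (by ring))

/-- Inside a block, the deviation grows at most by a multiple of `μ`. -/
lemma RiskAndLoss.norm_deviation_le (hA : S.CombinationMatrix) (hT : 0 < S.T) {G : ℝ}
    (hG0 : 0 ≤ G) (hG : ∀ k n, ‖S.lossGrad k n wo‖ ≤ G) (i : ℕ) {t : ℕ} (ht : t ≤ S.T) :
    ‖S.deviation wo μ act ξ (i * S.T + t)‖
      ≤ ‖S.deviation wo μ act ξ (i * S.T)‖ + K * S.T * G * μ := by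
  have h1 := h.norm_blockGap_le (wo := wo) (act := act) (ξ := ξ) hδ hμ hμδ i t
  have h2 := h.norm_blockShift_le (act := act) (ξ := ξ) hδ hμ hμδ hG0 hG i t
  have h3 : (K : ℝ) * t * G * μ ≤ K * S.T * G * μ := by gcongr
  rcases ht.lt_or_eq with ht | rfl
  · rw [deviation_block i ht]
    exact (norm_add_le _ _).trans (by linarith)
  · have e : i * S.T + S.T = (i + 1) * S.T := by ring
    rw [e, deviation_block_end hT]
    have hB := hA.activeMatrix_mem (act i)
    refine (norm_add_le _ _).trans ?_
    have h4 := norm_mix_le hB (S.blockGap wo μ act ξ i S.T)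
    have h5 := norm_mix_le hB (S.blockShift wo μ act ξ i S.T)
    linarith

/-- If all agents are active in the block, the first step bounds the gap of the trajectories at
the end of the block. -/
lemma RiskAndLoss.norm_blockGap_sq_le (hT : 0 < S.T) {i : ℕ} (hact : ∀ k, act i k = true) :
    ‖S.blockGap wo μ act ξ i S.T‖ ^ 2
      ≤ ∑ k, ‖S.deviation wo μ act ξ (i * S.T) k
          - μ • (S.lossGrad k (ξ (i * S.T + 1) k) (wo + S.deviation wo μ act ξ (i * S.T) k)
            - S.lossGrad k (ξ (i * S.T + 1) k) wo)‖ ^ 2 := by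
  rw [PiLp.norm_sq_eq_of_L2]
  refine Finset.sum_le_sum fun k _ => pow_le_pow_left₀ (norm_nonneg _) ?_ 2
  refine (norm_localDescent_sub_le_of_le (h.norm_blockStep_sub_le hδ hμ hμδ i k) _ _
    (show 1 ≤ S.T by omega)).trans (le_of_eq ?_)
  simp only [localDescent, hact, if_true, deviation, add_sub_cancel, blockGrad, add_zero,
    smul_sub]
  congr 1
  abel

/-- The pathwise bound on the fourth power of the deviation after a block.  Only the terms with
an indicator of full activity or with gradients at `wo` depend on the randomness of the block. -/
lemma RiskAndLoss.norm_deviation_pow_four_le (hA : S.CombinationMatrix) (hT : 0 < S.T)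
    [Nonempty (Fin K)] {G c₀ : ℝ} (hG0 : 0 ≤ G) (hG : ∀ k n, ‖S.lossGrad k n wo‖ ≤ G)
    (hc₀ : 0 ≤ c₀)
    (hAc : ∀ x : PiLp 2 (fun _ : Fin K => EuclideanSpace ℝ (Fin M)),
      ‖mix S.A x‖ ^ 2 ≤ ‖x‖ ^ 2 - c₀ * ‖x - mix (meanMatrix (Fin K)) x‖ ^ 2)
    {a r b : ℝ} (ha : a = S.T * δ) (hr : r = K * S.T * G)
    (hb : b = 12 * a * r + 4 * (K * S.T ^ 2 * δ * G)) (i : ℕ)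
    {Y : PiLp 2 (fun _ : Fin K => EuclideanSpace ℝ (Fin M))}
    (hY : Y = S.deviation wo μ act ξ (i * S.T)) :
    ‖S.deviation wo μ act ξ ((i + 1) * S.T)‖ ^ 4
      ≤ ‖Y‖ ^ 4
        - (if ∀ k, act i k = true then 1 else 0) * (‖Y‖ ^ 2 * (‖Y‖ ^ 2
          - ∑ k, ‖Y k - μ • (S.lossGrad k (ξ (i * S.T + 1) k) (wo + Y k)
            - S.lossGrad k (ξ (i * S.T + 1) k) wo)‖ ^ 2))
        - (if ∀ k, act i k = true then 1 else 0) * (‖Y‖ ^ 2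
          * (c₀ / 2 * ‖Y - mix (meanMatrix (Fin K)) Y‖ ^ 2 - 4 * c₀ * a ^ 2 * μ ^ 2 * ‖Y‖ ^ 2))
        - 4 * (‖Y‖ ^ 2 * ∑ k, ∑ j ∈ Finset.range S.T, (if act i k then μ else 0)
          * inner ℝ (mix (meanMatrix (Fin K)) Y k) (S.lossGrad k (ξ (i * S.T + j + 1) k) wo))
        + (‖Y‖ ^ 2 * (b * μ ^ 2 * ‖Y‖ + 20 * r * μ * ‖Y - mix (meanMatrix (Fin K)) Y‖
            + 8 * r ^ 2 * μ ^ 2) + 3 * r ^ 4 * μ ^ 4) := by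
  set X := S.blockGap wo μ act ξ i S.T with hX
  set c := S.blockShift wo μ act ξ i S.T with hc
  set P := mix (meanMatrix (Fin K)) Y with hP
  have hXY : ‖X‖ ≤ ‖Y‖ := hY ▸ h.norm_blockGap_le hδ hμ hμδ i S.T
  have hXY' : ‖X - Y‖ ≤ a * μ * ‖Y‖ := by
    rw [hY, ha]; exact h.norm_blockGap_sub_le hδ hμ hμδ i S.T
  have hcr : ‖c‖ ≤ r * μ := hr ▸ h.norm_blockShift_le hδ hμ hμδ hG0 hG i S.T
  have ha0 : 0 ≤ a := by rw [ha]; positivity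
  have hr0 : 0 ≤ r := by rw [hr]; positivity
  have hB := hA.activeMatrix_mem (act i)
  have h1 := norm_block_pow_four_le hB hμ ha0 hr0 hXY hXY' hcr
  rw [← hP, hX, hc, ← deviation_block_end hT, ← hX, ← hc] at h1
  have h2 : inner ℝ P c ≤ -(∑ k, ∑ j ∈ Finset.range S.T, (if act i k then μ else 0)
      * inner ℝ (P k) (S.lossGrad k (ξ (i * S.T + j + 1) k) wo))
      + ‖Y‖ * (K * S.T ^ 2 * δ * G * μ ^ 2) := by
    set γ : PiLp 2 (fun _ : Fin K => EuclideanSpace ℝ (Fin M)) :=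
      WithLp.toLp 2 fun k => (if act i k then μ else 0 : ℝ) •
        ∑ j ∈ Finset.range S.T, S.blockGrad ξ i k j wo with hγ
    have h3 : ‖c + γ‖ ≤ K * S.T ^ 2 * δ * G * μ ^ 2 :=
      h.norm_blockShift_add_le hδ hμ hμδ hG0 hG i S.T
    have h4 : inner ℝ P γ = ∑ k, ∑ j ∈ Finset.range S.T, (if act i k then μ else 0)
        * inner ℝ (P k) (S.lossGrad k (ξ (i * S.T + j + 1) k) wo) := by
      simp only [PiLp.inner_apply, hγ, inner_smul_right, inner_sum, Finset.mul_sum, blockGrad]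
    have h5 : inner ℝ P c = - inner ℝ P γ + inner ℝ P (c + γ) := by
      rw [inner_add_right]; ring
    rw [h5, h4]
    gcongr
    refine (real_inner_le_norm _ _).trans ?_
    gcongr
    exact norm_mix_le meanMatrix_mem Y
  have h6 : ‖mix (S.activeMatrix (act i)) X‖ ^ 2 ≤ ‖Y‖ ^ 2
      - (if ∀ k, act i k = true then 1 else 0) * (‖Y‖ ^ 2
          - ∑ k, ‖Y k - μ • (S.lossGrad k (ξ (i * S.T + 1) k) (wo + Y k)
            - S.lossGrad k (ξ (i * S.T + 1) k) wo)‖ ^ 2)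
      - (if ∀ k, act i k = true then 1 else 0) * (c₀ / 2 * ‖Y - P‖ ^ 2
          - 4 * c₀ * a ^ 2 * μ ^ 2 * ‖Y‖ ^ 2) := by
    by_cases hall : ∀ k, act i k = true
    · rw [if_pos hall, hA.activeMatrix_of_forall hall]
      have h7 := norm_mix_sq_le_of_near hc₀ hAc hXY'
      have h8 := h.norm_blockGap_sq_le (wo := wo) (ξ := ξ) hδ hμ hμδ hT hall
      rw [← hY, ← hX] at h8
      linarith
    · rw [if_neg hall]
      have : ‖mix (S.activeMatrix (act i)) X‖ ^ 2 ≤ ‖Y‖ ^ 2 := by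
        gcongr; exact (norm_mix_le hB X).trans hXY
      linarith
  have h9 := mul_le_mul_of_nonneg_left h6 (sq_nonneg ‖Y‖)
  have h10 := mul_le_mul_of_nonneg_left h2 (sq_nonneg ‖Y‖)
  have h11 : ‖Y‖ ^ 2 * (b * μ ^ 2 * ‖Y‖) = ‖Y‖ ^ 2 * (12 * a * r * μ ^ 2 * ‖Y‖)
      + 4 * (‖Y‖ ^ 2 * (‖Y‖ * (K * S.T ^ 2 * δ * G * μ ^ 2))) := by rw [hb]; ring
  linarith

end

end Setup

namespace Setup

variable {K M : ℕ} {𝒳 : Type*} {S : Setup K M 𝒳} {ν δ : ℝ}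

/-! ### The gap between the algorithm and the long-term model -/

/-- The difference of the errors of the algorithm and of the long-term model started at `v₀`. -/
noncomputable def longTermGap (S : Setup K M 𝒳) (wo : EuclideanSpace ℝ (Fin M))
    (v₀ : Fin K → EuclideanSpace ℝ (Fin M)) (μ : ℝ)
    (act : ℕ → Fin K → Bool) (ξ : ℕ → (k : Fin K) → Fin (S.N k)) (n : ℕ) :
    PiLp 2 (fun _ : Fin K => EuclideanSpace ℝ (Fin M)) :=
  WithLp.toLp 2 fun k => S.error wo μ act ξ n k - S.longTerm wo v₀ μ act ξ n k

variable {wo : EuclideanSpace ℝ (Fin M)} {v₀ : Fin K → EuclideanSpace ℝ (Fin M)} {μ : ℝ}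
  {act : ℕ → Fin K → Bool} {ξ : ℕ → (k : Fin K) → Fin (S.N k)}

lemma CombinationMatrix.stepMatrix_mem (hA : S.CombinationMatrix) (n : ℕ) :
    S.stepMatrix act n ∈ doublyStochastic ℝ (Fin K) := by
  unfold stepMatrix
  split_ifs
  · exact hA.activeMatrix_mem _
  · exact one_mem _

/-- The gradient noises cancel in the gap, which is driven by the linearization errors alone. -/
lemma longTermGap_succ (hA : S.CombinationMatrix) (n : ℕ) :
    S.longTermGap wo v₀ μ act ξ (n + 1) = mix (S.stepMatrix act n)
      ((WithLp.toLp 2 fun ℓ => S.longTermGap wo v₀ μ act ξ n ℓ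
          - S.stepSize μ act n ℓ • S.riskHess ℓ wo (S.longTermGap wo v₀ μ act ξ n ℓ))
        + WithLp.toLp 2 fun ℓ => S.stepSize μ act n ℓ •
            (S.riskGrad ℓ (wo + S.deviation wo μ act ξ n ℓ) - S.riskGrad ℓ wo
              - S.riskHess ℓ wo (S.deviation wo μ act ξ n ℓ))) := by
  ext1 k
  have h1 : wo = ∑ ℓ, S.stepMatrix act n ℓ k • wo := by
    rw [← Finset.sum_smul, sum_col_of_mem_doublyStochastic (hA.stepMatrix_mem n), one_smul]
  simp only [longTermGap, mix_apply, error, model, longTerm]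
  conv_lhs => enter [1, 1]; rw [h1]
  rw [← Finset.sum_sub_distrib, ← Finset.sum_sub_distrib]
  refine Finset.sum_congr rfl fun ℓ _ => ?_
  rw [← smul_sub, ← smul_sub]
  congr 1
  simp only [PiLp.add_apply, deviation, gradNoise, add_sub_cancel, map_sub, smul_sub, smul_neg]
  abel

variable (h : S.RiskAndLoss ν δ) (hδ : 0 < δ) (hν : 0 ≤ ν) (hA : S.CombinationMatrix)
  (hμ : 0 ≤ μ) (hμδ : μ * δ ^ 2 ≤ ν) (hμν : μ * ν ≤ 1) {C : ℝ} (hC : 0 ≤ C)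
  (hquad : ∀ k y, ‖S.riskGrad k (wo + y) - S.riskGrad k wo - S.riskHess k wo y‖ ≤ C * ‖y‖ ^ 2)
include h hδ hν hA hμ hμδ hμν hC hquad

lemma RiskAndLoss.norm_longTermGap_succ_le (n : ℕ) :
    ‖S.longTermGap wo v₀ μ act ξ (n + 1)‖
      ≤ (1 - (if ∀ k, act (n / S.T) k = true then 1 else 0) * (μ * ν / 2))
          * ‖S.longTermGap wo v₀ μ act ξ n‖ + μ * (C * ‖S.deviation wo μ act ξ n‖ ^ 2) := by
  rw [longTermGap_succ hA]
  refine (norm_mix_le (hA.stepMatrix_mem n) _).trans ((norm_add_le _ _).trans ?_)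
  have hs0 : ∀ k, 0 ≤ S.stepSize μ act n k := fun k => ite_step_nonneg hμ _
  have hs1 : ∀ k, S.stepSize μ act n k ≤ μ := fun k => ite_step_le hμ _
  refine add_le_add ?_ ?_
  · refine norm_le_mul_norm_of_forall ?_ fun k => ?_
    · split_ifs <;> nlinarith
    · by_cases hall : ∀ k, act (n / S.T) k = true
      · simp only [hall, implies_true, if_true, one_mul, stepSize]
        exact h.norm_sub_smul_riskHess_le hδ.le hμ hμδ hμν k wo _
      · rw [if_neg hall, zero_mul, sub_zero, one_mul]
        by_cases hk : act (n / S.T) k = true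
        · simp only [stepSize, hk, if_true]
          refine (h.norm_sub_smul_riskHess_le hδ.le hμ hμδ hμν k wo _).trans ?_
          exact mul_le_of_le_one_left (norm_nonneg _) (by nlinarith)
        · simp [stepSize, hk]
  · rw [pow_two, ← mul_assoc, ← mul_assoc]
    refine norm_le_mul_norm_of_forall (by positivity) fun k => ?_
    simp only [norm_smul, Real.norm_eq_abs, abs_of_nonneg (hs0 k)]
    have h1 := hquad k (S.deviation wo μ act ξ n k)
    have h2 : ‖S.deviation wo μ act ξ n k‖ ≤ ‖S.deviation wo μ act ξ n‖ :=
      PiLp.norm_apply_le _ _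
    calc _ ≤ μ * (C * ‖S.deviation wo μ act ξ n k‖ ^ 2) := by gcongr; exact hs1 k
      _ = μ * C * ‖S.deviation wo μ act ξ n k‖ * ‖S.deviation wo μ act ξ n k‖ := by ring
      _ ≤ _ := by gcongr

/-- The growth of the gap from the start of block `i` to the position `t ≥ 1` in the block; the
contraction comes from the first step. -/
lemma RiskAndLoss.norm_longTermGap_block_le (i : ℕ) {Ymax : ℝ}
    (hY : ∀ t < S.T, ‖S.deviation wo μ act ξ (i * S.T + t)‖ ≤ Ymax) {t : ℕ} (ht1 : 1 ≤ t)
    (ht : t ≤ S.T) :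
    ‖S.longTermGap wo v₀ μ act ξ (i * S.T + t)‖
      ≤ (1 - (if ∀ k, act i k = true then 1 else 0) * (μ * ν / 2))
          * ‖S.longTermGap wo v₀ μ act ξ (i * S.T)‖ + t * (μ * (C * Ymax ^ 2)) := by
  induction t, ht1 using Nat.le_induction with
  | base =>
    have h1 := h.norm_longTermGap_succ_le (v₀ := v₀) (act := act) (ξ := ξ) hδ hν hA hμ hμδ hμν
      hC hquad (i * S.T)
    have h2 := hY 0 (by omega)
    rw [add_zero] at h2
    have h3 := block_div (S := S) i (show 0 < S.T by omega)
    rw [add_zero] at h3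
    rw [h3] at h1
    refine h1.trans ?_
    rw [Nat.cast_one, one_mul]
    gcongr
  | succ t ht1 ih =>
    have h1 := h.norm_longTermGap_succ_le (v₀ := v₀) (act := act) (ξ := ξ) hδ hν hA hμ hμδ hμν
      hC hquad (i * S.T + t)
    have h2 := hY t (by omega)
    have h3 : (1 - (if ∀ k, act ((i * S.T + t) / S.T) k = true then 1 else 0) * (μ * ν / 2))
        * ‖S.longTermGap wo v₀ μ act ξ (i * S.T + t)‖
        ≤ ‖S.longTermGap wo v₀ μ act ξ (i * S.T + t)‖ :=
      mul_le_of_le_one_left (norm_nonneg _) (by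
        have : 0 ≤ μ * ν := by positivity
        split_ifs <;> linarith)
    have h4 : μ * (C * ‖S.deviation wo μ act ξ (i * S.T + t)‖ ^ 2) ≤ μ * (C * Ymax ^ 2) := by
      gcongr
    have h5 := ih (by omega)
    rw [← add_assoc]
    push_cast
    linarith

end Setup

/-! ### Random variables with finitely many values -/

section FinitelyMeasurable

variable {Ω : Type*}

/-- The function `f` has finitely many values, and all its level sets are measurable with respect
to `m`.  Such functions are stable under composition with arbitrary functions, so that no
measurability in the state space has to be checked. -/
def FinitelyMeasurable {β : Type*} (m : MeasurableSpace Ω) (f : Ω → β) : Prop :=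
  (Set.range f).Finite ∧ ∀ s : Set β, MeasurableSet[m] (f ⁻¹' s)

namespace FinitelyMeasurable

variable {β γ η : Type*} {m m' : MeasurableSpace Ω}

lemma mono {f : Ω → β} (hf : FinitelyMeasurable m f) (hm : m ≤ m') : FinitelyMeasurable m' f :=
  ⟨hf.1, fun s => hm _ (hf.2 s)⟩

lemma const (b : β) : FinitelyMeasurable m fun _ : Ω => b :=
  ⟨(Set.finite_singleton b).subset (by rintro _ ⟨_, rfl⟩; rfl),
    fun s => @MeasurableSet.const Ω m (b ∈ s)⟩

lemma comp {f : Ω → β} (hf : FinitelyMeasurable m f) (F : β → γ) :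
    FinitelyMeasurable m fun ω => F (f ω) :=
  ⟨by
    have := hf.1.image F
    rwa [← Set.range_comp] at this, fun s => hf.2 (F ⁻¹' s)⟩

lemma pi {ι : Type*} [Finite ι] {β : ι → Type*} {f : (i : ι) → Ω → β i}
    (hf : ∀ i, FinitelyMeasurable m (f i)) : FinitelyMeasurable m fun ω i => f i ω := by
  have hfin : (Set.univ.pi fun i => Set.range (f i)).Finite := Set.Finite.pi fun i => (hf i).1
  refine ⟨hfin.subset (by rintro _ ⟨ω, rfl⟩ i _; exact ⟨ω, rfl⟩), fun s => ?_⟩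
  have e : (fun ω i => f i ω) ⁻¹' s
      = ⋃ x ∈ (Set.univ.pi fun i => Set.range (f i)) ∩ s, ⋂ i, f i ⁻¹' {x i} := by
    ext ω
    simp only [Set.mem_preimage, Set.mem_iUnion, Set.mem_iInter, Set.mem_singleton_iff]
    refine ⟨fun hω => ⟨fun i => f i ω, ⟨fun i _ => ⟨ω, rfl⟩, hω⟩, fun i => rfl⟩, ?_⟩
    rintro ⟨x, ⟨-, hx⟩, hx'⟩
    rwa [show (fun i => f i ω) = x from funext hx']
  rw [e]
  exact Set.Finite.measurableSet_biUnion (hfin.subset Set.inter_subset_left) fun x _ =>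
    MeasurableSet.iInter fun i => (hf i).2 _

lemma comp₂ {f : Ω → β} {g : Ω → γ} (hf : FinitelyMeasurable m f) (hg : FinitelyMeasurable m g)
    (F : β → γ → η) : FinitelyMeasurable m fun ω => F (f ω) (g ω) := by
  have hp : FinitelyMeasurable m fun ω => (f ω, g ω) := by
    have hfin := hf.1.prod hg.1
    refine ⟨hfin.subset (by rintro _ ⟨ω, rfl⟩; exact ⟨⟨ω, rfl⟩, ⟨ω, rfl⟩⟩), fun s => ?_⟩
    have e : (fun ω => (f ω, g ω)) ⁻¹' s
        = ⋃ x ∈ (Set.range f ×ˢ Set.range g) ∩ s, f ⁻¹' {x.1} ∩ g ⁻¹' {x.2} := by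
      ext ω
      simp only [Set.mem_preimage, Set.mem_iUnion, Set.mem_inter_iff, Set.mem_singleton_iff]
      refine ⟨fun hω => ⟨(f ω, g ω), ⟨⟨⟨ω, rfl⟩, ⟨ω, rfl⟩⟩, hω⟩, rfl, rfl⟩, ?_⟩
      rintro ⟨x, ⟨-, hx⟩, h1, h2⟩
      rwa [h1, h2]
    rw [e]
    exact Set.Finite.measurableSet_biUnion (hfin.subset Set.inter_subset_left) fun x _ =>
      (hf.2 _).inter (hg.2 _)
  exact hp.comp fun x => F x.1 x.2

lemma finset_sum {ι : Type*} {s : Finset ι} {f : ι → Ω → ℝ}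
    (hf : ∀ i ∈ s, FinitelyMeasurable m (f i)) :
    FinitelyMeasurable m fun ω => ∑ i ∈ s, f i ω := by
  classical
  induction s using Finset.induction_on with
  | empty => simpa using const 0
  | insert i s hi ih =>
    simp only [Finset.sum_insert hi]
    exact (hf i (Finset.mem_insert_self i s)).comp₂
      (ih fun j hj => hf j (Finset.mem_insert_of_mem hj)) fun a b => a + b

lemma measurable [MeasurableSpace β] {f : Ω → β} (hf : FinitelyMeasurable m f) :
    Measurable[m] f := fun s _ => hf.2 s

lemma integrable {mΩ : MeasurableSpace Ω} {P : Measure Ω} [IsFiniteMeasure P] {f : Ω → ℝ}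
    (hf : FinitelyMeasurable mΩ f) : Integrable f P := by
  obtain ⟨C, hC⟩ := (hf.1.image fun x => ‖x‖).bddAbove
  exact Integrable.of_bound hf.measurable.aestronglyMeasurable C
    (Eventually.of_forall fun ω => hC ⟨f ω, ⟨ω, rfl⟩, rfl⟩)

end FinitelyMeasurable

end FinitelyMeasurable

namespace Setup

variable {K M : ℕ} {𝒳 : Type*} {S : Setup K M 𝒳} {ν δ : ℝ}
variable {Ω : Type*}

/-! ### Independence of the blocks -/

/-- The σ-algebra generated by the activations and the sampled indices with labels in `I`, where
`Sum.inl (i, k)` labels the activation of agent `k` in block `i` and `Sum.inr (n, k)` the index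
that `k` draws at time `n`. -/
abbrev envSigma (S : Setup K M 𝒳) (act : ℕ → Fin K → Ω → Bool)
    (ξ : ℕ → (k : Fin K) → Ω → Fin (S.N k)) (I : Set ((ℕ × Fin K) ⊕ (ℕ × Fin K))) :
    MeasurableSpace Ω :=
  ⨆ p ∈ I, Sum.elim (fun p : ℕ × Fin K => MeasurableSpace.comap (act p.1 p.2) ⊤)
    (fun p : ℕ × Fin K => MeasurableSpace.comap (ξ p.1 p.2) ⊤) p

/-- The labels of the random variables that determine the states at time `n`. -/
def past (S : Setup K M 𝒳) (n : ℕ) : Set ((ℕ × Fin K) ⊕ (ℕ × Fin K)) :=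
  {p | Sum.elim (fun p : ℕ × Fin K => p.1 * S.T < n) (fun p : ℕ × Fin K => p.1 ≤ n) p}

variable {act : ℕ → Fin K → Ω → Bool} {ξ : ℕ → (k : Fin K) → Ω → Fin (S.N k)}

lemma envSigma_mono {I J : Set ((ℕ × Fin K) ⊕ (ℕ × Fin K))} (hIJ : I ⊆ J) :
    S.envSigma act ξ I ≤ S.envSigma act ξ J :=
  biSup_mono hIJ

lemma finitelyMeasurable_act {I : Set ((ℕ × Fin K) ⊕ (ℕ × Fin K))} {i : ℕ} {k : Fin K}
    (hI : Sum.inl (i, k) ∈ I) : FinitelyMeasurable (S.envSigma act ξ I) (act i k) := by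
  refine ⟨Set.toFinite _, fun s => ?_⟩
  have h1 : MeasurableSpace.comap (act i k) ⊤ ≤ S.envSigma act ξ I :=
    le_biSup (f := Sum.elim (fun p : ℕ × Fin K => MeasurableSpace.comap (act p.1 p.2) ⊤)
      (fun p : ℕ × Fin K => MeasurableSpace.comap (ξ p.1 p.2) ⊤)) hI
  exact h1 _ ⟨s, trivial, rfl⟩

lemma finitelyMeasurable_sample {I : Set ((ℕ × Fin K) ⊕ (ℕ × Fin K))} {n : ℕ} {k : Fin K}
    (hI : Sum.inr (n, k) ∈ I) : FinitelyMeasurable (S.envSigma act ξ I) (ξ n k) := by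
  refine ⟨Set.toFinite _, fun s => ?_⟩
  have h1 : MeasurableSpace.comap (ξ n k) ⊤ ≤ S.envSigma act ξ I :=
    le_biSup (f := Sum.elim (fun p : ℕ × Fin K => MeasurableSpace.comap (act p.1 p.2) ⊤)
      (fun p : ℕ × Fin K => MeasurableSpace.comap (ξ p.1 p.2) ⊤)) hI
  exact h1 _ ⟨s, trivial, rfl⟩

lemma past_mono {n n' : ℕ} (hn : n ≤ n') : S.past n ⊆ S.past n' := by
  rintro (p | p) hp
  · exact lt_of_lt_of_le hp hn
  · exact le_trans hp hn

lemma act_mem_past (n : ℕ) (k : Fin K) : Sum.inl (n / S.T, k) ∈ S.past (n + 1) :=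
  Nat.lt_succ_of_le (Nat.div_mul_le_self n S.T)

lemma sample_mem_past (n : ℕ) (k : Fin K) : Sum.inr (n, k) ∈ S.past n :=
  le_refl n

lemma finitelyMeasurable_model (μ : ℝ) (n : ℕ) :
    FinitelyMeasurable (S.envSigma act ξ (S.past n))
      (fun ω => S.model μ (fun i k => act i k ω) (fun m k => ξ m k ω) n) := by
  induction n with
  | zero => exact FinitelyMeasurable.const _
  | succ n ih =>
    have h1 := FinitelyMeasurable.pi fun k =>
      finitelyMeasurable_act (act := act) (ξ := ξ) (act_mem_past (S := S) n k)
    have h2 := FinitelyMeasurable.pi fun k =>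
      finitelyMeasurable_sample (act := act) (ξ := ξ) (sample_mem_past (S := S) (n + 1) k)
    exact (ih.mono (envSigma_mono (past_mono n.le_succ))).comp₂
      (h1.comp₂ h2 fun α x => (α, x)) fun w e k => ∑ ℓ,
        (if n % S.T + 1 = S.T then S.activeMatrix e.1 else 1) ℓ k •
          (w ℓ - (if e.1 ℓ then μ else 0 : ℝ) • S.lossGrad ℓ (e.2 ℓ) (w ℓ))

lemma finitelyMeasurable_longTerm (wo : EuclideanSpace ℝ (Fin M))
    (v₀ : Fin K → EuclideanSpace ℝ (Fin M)) (μ : ℝ) (n : ℕ) :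
    FinitelyMeasurable (S.envSigma act ξ (S.past n))
      (fun ω => S.longTerm wo v₀ μ (fun i k => act i k ω) (fun m k => ξ m k ω) n) := by
  induction n with
  | zero => exact FinitelyMeasurable.const _
  | succ n ih =>
    have h1 := FinitelyMeasurable.pi fun k =>
      finitelyMeasurable_act (act := act) (ξ := ξ) (act_mem_past (S := S) n k)
    have h2 := FinitelyMeasurable.pi fun k =>
      finitelyMeasurable_sample (act := act) (ξ := ξ) (sample_mem_past (S := S) (n + 1) k)
    have h3 := (finitelyMeasurable_model (S := S) (act := act) (ξ := ξ) μ n).mono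
      (envSigma_mono (past_mono n.le_succ))
    exact ((ih.mono (envSigma_mono (past_mono n.le_succ))).comp₂ h3 fun v w => (v, w)).comp₂
      (h1.comp₂ h2 fun α x => (α, x)) fun u e k => ∑ ℓ,
        (if n % S.T + 1 = S.T then S.activeMatrix e.1 else 1) ℓ k •
          (u.1 ℓ - (if e.1 ℓ then μ else 0 : ℝ) • S.riskHess ℓ wo (u.1 ℓ)
            - (if e.1 ℓ then μ else 0 : ℝ) • (-S.riskGrad ℓ wo)
            + (if e.1 ℓ then μ else 0 : ℝ) •
              (S.lossGrad ℓ (e.2 ℓ) (u.2 ℓ) - S.riskGrad ℓ (u.2 ℓ)))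

lemma finitelyMeasurable_deviation (wo : EuclideanSpace ℝ (Fin M)) (μ : ℝ) (n : ℕ) :
    FinitelyMeasurable (S.envSigma act ξ (S.past n))
      (fun ω => S.deviation wo μ (fun i k => act i k ω) (fun m k => ξ m k ω) n) :=
  (finitelyMeasurable_model μ n).comp fun w => WithLp.toLp 2 fun k => w k - wo

lemma finitelyMeasurable_longTermGap (wo : EuclideanSpace ℝ (Fin M))
    (v₀ : Fin K → EuclideanSpace ℝ (Fin M)) (μ : ℝ) (n : ℕ) :
    FinitelyMeasurable (S.envSigma act ξ (S.past n))
      (fun ω => S.longTermGap wo v₀ μ (fun i k => act i k ω) (fun m k => ξ m k ω) n) :=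
  (finitelyMeasurable_model μ n).comp₂ (finitelyMeasurable_longTerm wo v₀ μ n)
    fun w v => WithLp.toLp 2 fun k => wo - w k - v k

namespace Environment

variable [mΩ : MeasurableSpace Ω] {P : Measure Ω}

lemma elim_le (henv : S.Environment P act ξ) (p : (ℕ × Fin K) ⊕ (ℕ × Fin K)) :
    Sum.elim (fun p : ℕ × Fin K => MeasurableSpace.comap (act p.1 p.2) ⊤)
      (fun p : ℕ × Fin K => MeasurableSpace.comap (ξ p.1 p.2) ⊤) p ≤ mΩ := by
  rcases p with p | p
  · exact (henv.measurable_act p.1 p.2).comap_le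
  · exact (henv.measurable_sample p.1 p.2).comap_le

lemma envSigma_le (henv : S.Environment P act ξ) (I : Set ((ℕ × Fin K) ⊕ (ℕ × Fin K))) :
    S.envSigma act ξ I ≤ mΩ :=
  iSup₂_le fun p _ => henv.elim_le p

lemma integral_mul (henv : S.Environment P act ξ) {I J : Set ((ℕ × Fin K) ⊕ (ℕ × Fin K))}
    (hIJ : Disjoint I J) {f g : Ω → ℝ} (hf : FinitelyMeasurable (S.envSigma act ξ I) f)
    (hg : FinitelyMeasurable (S.envSigma act ξ J) g) :
    ∫ ω, f ω * g ω ∂P = (∫ ω, f ω ∂P) * ∫ ω, g ω ∂P := by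
  have h1 : Indep (S.envSigma act ξ I) (S.envSigma act ξ J) P :=
    indep_iSup_of_disjoint henv.elim_le henv.indep hIJ
  have h2 : IndepFun f g P := by
    rw [IndepFun_iff_Indep]
    exact indep_of_indep_of_le h1 hf.measurable.comap_le hg.measurable.comap_le
  exact h2.integral_fun_mul_eq_mul_integral
    (hf.mono (henv.envSigma_le I)).measurable.aestronglyMeasurable
    (hg.mono (henv.envSigma_le J)).measurable.aestronglyMeasurable

lemma integral_mul_act (henv : S.Environment P act ξ) {i : ℕ} {k : Fin K} (hq : 0 ≤ S.q k)
    {I : Set ((ℕ × Fin K) ⊕ (ℕ × Fin K))} (hI : Sum.inl (i, k) ∉ I) {f : Ω → ℝ}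
    (hf : FinitelyMeasurable (S.envSigma act ξ I) f) (μ : ℝ) :
    ∫ ω, f ω * (if act i k ω then μ else 0) ∂P = S.q k * μ * ∫ ω, f ω ∂P := by
  rw [henv.integral_mul (Set.disjoint_singleton_right.2 hI) hf
    ((finitelyMeasurable_act (Set.mem_singleton (Sum.inl (i, k)))).comp
      fun b : Bool => (if b then μ else 0 : ℝ))]
  have h1 : MeasurableSet {ω | act i k ω = true} :=
    henv.measurable_act i k (MeasurableSet.singleton true)
  have h2 : ∀ ω, (if act i k ω then μ else 0 : ℝ)
      = Set.indicator {ω | act i k ω = true} (fun _ => μ) ω := fun ω => by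
    simp [Set.indicator_apply]
  simp only [h2]
  rw [integral_indicator_const _ h1, measureReal_def, henv.prob_act, ENNReal.toReal_ofReal hq,
    smul_eq_mul]
  ring

lemma integral_mul_allActive (henv : S.Environment P act ξ) (hq : ∀ k, 0 ≤ S.q k) {i : ℕ}
    {I : Set ((ℕ × Fin K) ⊕ (ℕ × Fin K))} (hI : ∀ k, Sum.inl (i, k) ∉ I) {f : Ω → ℝ}
    (hf : FinitelyMeasurable (S.envSigma act ξ I) f) :
    ∫ ω, f ω * (if ∀ k, act i k ω = true then 1 else 0) ∂P = (∏ k, S.q k) * ∫ ω, f ω ∂P := by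
  have hd : Disjoint I (Set.range fun k => Sum.inl (i, k)) :=
    Set.disjoint_right.2 (by rintro _ ⟨k, rfl⟩; exact hI k)
  rw [henv.integral_mul hd hf ((FinitelyMeasurable.pi fun k =>
    finitelyMeasurable_act (Set.mem_range_self k)).comp
      fun α : Fin K → Bool => (if ∀ k, α k = true then 1 else 0 : ℝ))]
  have h1 : MeasurableSet (⋂ k, {ω | act i k ω = true}) := MeasurableSet.iInter fun k =>
    henv.measurable_act i k (MeasurableSet.singleton true)
  have h2 : ∀ ω, (if ∀ k, act i k ω = true then 1 else 0 : ℝ)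
      = Set.indicator (⋂ k, {ω | act i k ω = true}) (fun _ => 1) ω := fun ω => by
    by_cases hω : ∀ k, act i k ω = true
    · have hmem : ω ∈ ⋂ k, {ω | act i k ω = true} := Set.mem_iInter.2 hω
      rw [if_pos hω, Set.indicator_of_mem hmem]
    · have hmem : ω ∉ ⋂ k, {ω | act i k ω = true} := fun h => hω fun k => by simpa using Set.mem_iInter.1 h k
      rw [if_neg hω, Set.indicator_of_notMem hmem]
  have h3 : P (⋂ k, {ω | act i k ω = true}) = ∏ k, ENNReal.ofReal (S.q k) := by
    have hinj : Function.Injective fun k : Fin K =>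
        (Sum.inl (i, k) : (ℕ × Fin K) ⊕ (ℕ × Fin K)) := fun a b hab => by simpa using hab
    exact ((henv.indep.precomp hinj).meas_iInter (s := fun k => {ω | act i k ω = true})
      fun k => ⟨{true}, trivial, rfl⟩).trans (Finset.prod_congr rfl fun k _ => henv.prob_act i k)
  rw [mul_comm]
  congr 1
  refine (integral_congr_ae (Eventually.of_forall h2)).trans ?_
  rw [integral_indicator_const _ h1, measureReal_def, h3, ENNReal.toReal_prod, smul_eq_mul,
    mul_one]
  exact Finset.prod_congr rfl fun k _ => ENNReal.toReal_ofReal (hq k)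

variable [IsProbabilityMeasure P]

/-- The expectation over a sampled index is the mean over the local dataset. -/
lemma integral_sample (henv : S.Environment P act ξ) {n : ℕ} {k : Fin K}
    {I : Set ((ℕ × Fin K) ⊕ (ℕ × Fin K))} (hI : Sum.inr (n, k) ∉ I) {f : Fin (S.N k) → Ω → ℝ}
    (hf : ∀ j, FinitelyMeasurable (S.envSigma act ξ I) (f j)) :
    ∫ ω, f (ξ n k ω) ω ∂P = ∫ ω, (1 / (S.N k : ℝ)) * ∑ j, f j ω ∂P := by
  have hint : ∀ j, Integrable (f j) P := fun j =>
    ((hf j).mono (henv.envSigma_le I)).integrable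
  have hfi : ∀ j, FinitelyMeasurable (S.envSigma act ξ {Sum.inr (n, k)})
      (fun ω => if ξ n k ω = j then 1 else 0 : Ω → ℝ) := fun j =>
    (finitelyMeasurable_sample (Set.mem_singleton (Sum.inr (n, k)))).comp
      fun x => (if x = j then 1 else 0 : ℝ)
  have h1 : ∀ ω, f (ξ n k ω) ω = ∑ j, f j ω * (if ξ n k ω = j then 1 else 0) := fun ω => by
    simp
  have h2 : ∀ j, ∫ ω, f j ω * (if ξ n k ω = j then 1 else 0) ∂P
      = (1 / (S.N k : ℝ)) * ∫ ω, f j ω ∂P := by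
    intro j
    rw [henv.integral_mul (Set.disjoint_singleton_right.2 hI) (hf j) (hfi j), mul_comm]
    congr 1
    have h3 : MeasurableSet {ω | ξ n k ω = j} :=
      henv.measurable_sample n k (MeasurableSet.singleton j)
    have h4 : ∀ ω, (if ξ n k ω = j then 1 else 0 : ℝ)
        = Set.indicator {ω | ξ n k ω = j} (fun _ => 1) ω := fun ω => by
      simp [Set.indicator_apply]
    simp only [h4]
    rw [integral_indicator_const _ h3, measureReal_def, henv.prob_sample]
    simp
  simp only [h1]
  rw [integral_finsetSum _ fun j _ => (((hf j).mono (henv.envSigma_le I)).comp₂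
    ((hfi j).mono (henv.envSigma_le _)) fun a b => a * b).integrable, integral_const_mul,
    integral_finsetSum _ fun j _ => hint j, Finset.mul_sum]
  exact Finset.sum_congr rfl fun j _ => h2 j

end Environment

end Setup

namespace Setup

variable {K M : ℕ} {𝒳 : Type*} {S : Setup K M 𝒳} {ν δ : ℝ}
variable {Ω : Type*} {act : ℕ → Fin K → Ω → Bool} {ξ : ℕ → (k : Fin K) → Ω → Fin (S.N k)}

/-! ### The fourth moment of the deviation -/

lemma act_notMem_past (i : ℕ) (k : Fin K) :
    Sum.inl (i, k) ∉ S.past (i * S.T) := fun h => lt_irrefl _ (show i * S.T < i * S.T from h)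

lemma sample_notMem_past (n j : ℕ) (k : Fin K) : Sum.inr (n + j + 1, k) ∉ S.past n :=
  fun h => absurd (show n + j + 1 ≤ n from h) (by omega)

namespace Environment

variable [mΩ : MeasurableSpace Ω] {P : Measure Ω} [IsProbabilityMeasure P]

/-- The sampled gradients at `wo`, weighted with the random step-sizes, average to a multiple of
the gradient of the weighted risk, which vanishes at `wo`. -/
lemma integral_drift_eq_zero (henv : S.Environment P act ξ) (hq : ∀ k, 0 ≤ S.q k)
    (h : S.RiskAndLoss ν δ) {wo : EuclideanSpace ℝ (Fin M)}
    (hopt : ∑ k, S.q k • S.riskGrad k wo = 0) (μ : ℝ) (i : ℕ)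
    {v : Ω → EuclideanSpace ℝ (Fin M)}
    (hv : FinitelyMeasurable (S.envSigma act ξ (S.past (i * S.T))) v) :
    ∫ ω, ∑ k, ∑ j ∈ Finset.range S.T, (if act i k ω then μ else 0)
      * inner ℝ (v ω) (S.lossGrad k (ξ (i * S.T + j + 1) k ω) wo) ∂P = 0 := by
  have hvm := hv.mono (henv.envSigma_le _)
  have hactm : ∀ k, FinitelyMeasurable mΩ (act i k) := fun k =>
    (finitelyMeasurable_act (ξ := ξ) (Set.mem_univ _)).mono (henv.envSigma_le _)
  have hξm : ∀ n k, FinitelyMeasurable mΩ (ξ n k) := fun n k =>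
    (finitelyMeasurable_sample (act := act) (Set.mem_univ _)).mono (henv.envSigma_le _)
  have hterm : ∀ k j, FinitelyMeasurable mΩ fun ω => (if act i k ω then μ else 0)
      * inner ℝ (v ω) (S.lossGrad k (ξ (i * S.T + j + 1) k ω) wo) := fun k j =>
    (hactm k).comp₂ (hvm.comp₂ (hξm (i * S.T + j + 1) k)
      fun a b => inner ℝ a (S.lossGrad k b wo)) fun a b => (if a then μ else 0) * b
  have h1 : ∀ k j, ∫ ω, (if act i k ω then μ else 0)
      * inner ℝ (v ω) (S.lossGrad k (ξ (i * S.T + j + 1) k ω) wo) ∂P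
      = μ * ∫ ω, inner ℝ (v ω) (S.q k • S.riskGrad k wo) ∂P := by
    intro k j
    set I := S.past (i * S.T) ∪ {Sum.inl (i, k)} with hI
    have hvI : FinitelyMeasurable (S.envSigma act ξ I) v :=
      hv.mono (envSigma_mono Set.subset_union_left)
    have hactI : FinitelyMeasurable (S.envSigma act ξ I) (act i k) :=
      finitelyMeasurable_act (Or.inr rfl)
    have hnot : Sum.inr (i * S.T + j + 1, k) ∉ I := by
      rintro (hm | hm)
      · exact sample_notMem_past _ _ _ hm
      · exact absurd hm (by simp)
    rw [henv.integral_sample (f := fun n ω => (if act i k ω then μ else 0)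
      * inner ℝ (v ω) (S.lossGrad k n wo)) hnot fun n =>
        hactI.comp₂ hvI fun a b => (if a then μ else 0) * inner ℝ b (S.lossGrad k n wo)]
    have e : ∀ ω, (1 / (S.N k : ℝ)) * ∑ n, (if act i k ω then μ else 0)
        * inner ℝ (v ω) (S.lossGrad k n wo)
        = inner ℝ (v ω) (S.riskGrad k wo) * (if act i k ω then μ else 0) := by
      intro ω
      rw [h.riskGrad_eq, inner_smul_right, inner_sum, ← Finset.mul_sum]
      ring
    simp only [e]
    rw [henv.integral_mul_act (hq k) (act_notMem_past i k)
      (hv.comp fun a => inner ℝ a (S.riskGrad k wo))]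
    simp only [inner_smul_right]
    rw [integral_const_mul]
    ring
  rw [integral_finsetSum _ fun k _ => (FinitelyMeasurable.finset_sum fun j _ =>
    hterm k j).integrable]
  have h2 : ∀ k, ∫ ω, ∑ j ∈ Finset.range S.T, (if act i k ω then μ else 0)
      * inner ℝ (v ω) (S.lossGrad k (ξ (i * S.T + j + 1) k ω) wo) ∂P
      = S.T * μ * ∫ ω, inner ℝ (v ω) (S.q k • S.riskGrad k wo) ∂P := by
    intro k
    rw [integral_finsetSum _ fun j _ => (hterm k j).integrable,
      Finset.sum_congr rfl fun j _ => h1 k j]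
    simp [mul_assoc]
  rw [Finset.sum_congr rfl fun k _ => h2 k, ← Finset.mul_sum, ← integral_finsetSum _ fun k _ =>
    (hvm.comp fun a => inner ℝ a (S.q k • S.riskGrad k wo)).integrable]
  simp only [← inner_sum, hopt, inner_zero_right]
  simp

/-- The first step of a block with full activity contracts in the mean. -/
lemma integral_contraction_ge (henv : S.Environment P act ξ) (hq : ∀ k, 0 ≤ S.q k)
    (h : S.RiskAndLoss ν δ) (wo : EuclideanSpace ℝ (Fin M)) {μ : ℝ} (hμ : 0 ≤ μ)
    (hμδ : μ * δ ^ 2 ≤ ν) (i : ℕ)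
    {Y : Ω → PiLp 2 (fun _ : Fin K => EuclideanSpace ℝ (Fin M))}
    (hY : FinitelyMeasurable (S.envSigma act ξ (S.past (i * S.T))) Y) :
    (∏ k, S.q k) * (μ * ν * ∫ ω, ‖Y ω‖ ^ 4 ∂P)
      ≤ ∫ ω, (if ∀ k, act i k ω = true then 1 else 0) * (‖Y ω‖ ^ 2 * (‖Y ω‖ ^ 2
          - ∑ k, ‖Y ω k - μ • (S.lossGrad k (ξ (i * S.T + 1) k ω) (wo + Y ω k)
            - S.lossGrad k (ξ (i * S.T + 1) k ω) wo)‖ ^ 2)) ∂P := by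
  set I := S.past (i * S.T) ∪ Set.range fun k => Sum.inl (i, k) with hI
  have hYm := hY.mono (henv.envSigma_le _)
  have hYI : FinitelyMeasurable (S.envSigma act ξ I) Y :=
    hY.mono (envSigma_mono Set.subset_union_left)
  have hactI : FinitelyMeasurable (S.envSigma act ξ I) fun ω k => act i k ω :=
    FinitelyMeasurable.pi fun k => finitelyMeasurable_act (Or.inr ⟨k, rfl⟩)
  have hξm : ∀ n k, FinitelyMeasurable mΩ (ξ n k) := fun n k =>
    (finitelyMeasurable_sample (act := act) (Set.mem_univ _)).mono (henv.envSigma_le _)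
  have hq' : 0 ≤ ∏ k, S.q k := Finset.prod_nonneg fun k _ => hq k
  set F : (k : Fin K) → Fin (S.N k) → Ω → ℝ := fun k n ω =>
    ‖Y ω‖ ^ 2 * (‖Y ω k‖ ^ 2
      - ‖Y ω k - μ • (S.lossGrad k n (wo + Y ω k) - S.lossGrad k n wo)‖ ^ 2)
    * (if ∀ k, act i k ω = true then 1 else 0) with hF
  have hFI : ∀ k n, FinitelyMeasurable (S.envSigma act ξ I) (F k n) := fun k n =>
    hYI.comp₂ hactI fun y α => ‖y‖ ^ 2 * (‖y k‖ ^ 2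
      - ‖y k - μ • (S.lossGrad k n (wo + y k) - S.lossGrad k n wo)‖ ^ 2)
      * (if ∀ k, α k = true then 1 else 0)
  have hnot : ∀ k, Sum.inr (i * S.T + 1, k) ∉ I := by
    rintro k (hm | ⟨k', hm⟩)
    · exact sample_notMem_past _ 0 _ hm
    · exact absurd hm (by simp)
  have e : ∀ ω, (if ∀ k, act i k ω = true then 1 else 0) * (‖Y ω‖ ^ 2 * (‖Y ω‖ ^ 2
          - ∑ k, ‖Y ω k - μ • (S.lossGrad k (ξ (i * S.T + 1) k ω) (wo + Y ω k)
            - S.lossGrad k (ξ (i * S.T + 1) k ω) wo)‖ ^ 2))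
      = ∑ k, F k (ξ (i * S.T + 1) k ω) ω := by
    intro ω
    simp only [hF]
    rw [← Finset.sum_mul, ← Finset.mul_sum, Finset.sum_sub_distrib, ← PiLp.norm_sq_eq_of_L2,
      mul_comm]
  simp only [e]
  have hFξ : ∀ k, FinitelyMeasurable mΩ fun ω => F k (ξ (i * S.T + 1) k ω) ω := fun k =>
    (hξm (i * S.T + 1) k).comp₂ (hYm.comp₂ (hactI.mono (henv.envSigma_le _)) fun y α => (y, α))
      fun n p => ‖p.1‖ ^ 2 * (‖p.1 k‖ ^ 2
        - ‖p.1 k - μ • (S.lossGrad k n (wo + p.1 k) - S.lossGrad k n wo)‖ ^ 2)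
        * (if ∀ k, p.2 k = true then 1 else 0)
  rw [integral_finsetSum _ fun k _ => (hFξ k).integrable]
  have h1 : ∀ k, (∏ k, S.q k) * (μ * ν * ∫ ω, ‖Y ω‖ ^ 2 * ‖Y ω k‖ ^ 2 ∂P)
      ≤ ∫ ω, F k (ξ (i * S.T + 1) k ω) ω ∂P := by
    intro k
    rw [henv.integral_sample (hnot k) (hFI k)]
    have e2 : ∀ ω, (1 / (S.N k : ℝ)) * ∑ n, F k n ω = (‖Y ω‖ ^ 2 * (‖Y ω k‖ ^ 2
        - (1 / (S.N k : ℝ)) * ∑ n,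
          ‖Y ω k - μ • (S.lossGrad k n (wo + Y ω k) - S.lossGrad k n wo)‖ ^ 2))
        * (if ∀ k, act i k ω = true then 1 else 0) := by
      intro ω
      have hN := (S.N_cast_pos k).ne'
      simp only [hF]
      rw [← Finset.sum_mul, ← Finset.mul_sum, Finset.sum_sub_distrib, Finset.sum_const,
        Finset.card_univ, Fintype.card_fin, nsmul_eq_mul]
      field_simp
    simp only [e2]
    have hmeas := hY.comp fun y => ‖y‖ ^ 2 * (‖y k‖ ^ 2 - (1 / (S.N k : ℝ)) * ∑ n,
      ‖y k - μ • (S.lossGrad k n (wo + y k) - S.lossGrad k n wo)‖ ^ 2)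
    rw [henv.integral_mul_allActive hq (act_notMem_past i) hmeas, ← integral_const_mul]
    refine mul_le_mul_of_nonneg_left (integral_mono
      (hYm.comp fun y => μ * ν * (‖y‖ ^ 2 * ‖y k‖ ^ 2)).integrable
      (hmeas.mono (henv.envSigma_le _)).integrable fun ω => ?_) hq'
    have h2 := h.mean_norm_lossStep_sq_le hμ hμδ k wo (Y ω k)
    have h3 := mul_le_mul_of_nonneg_left h2 (sq_nonneg ‖Y ω‖)
    simp only
    linarith
  refine le_trans (le_of_eq ?_) (Finset.sum_le_sum fun k _ => h1 k)
  rw [← Finset.mul_sum, ← Finset.mul_sum, ← integral_finsetSum _ fun k _ =>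
    (hYm.comp fun y => ‖y‖ ^ 2 * ‖y k‖ ^ 2).integrable]
  simp only [← Finset.mul_sum, ← PiLp.norm_sq_eq_of_L2]
  congr 3
  ext ω
  ring

/-- Over a block, the fourth moment of the deviation contracts at a rate proportional to `μ`, up
to an error of order `μ ^ 3`. -/
lemma exists_fourth_moment_le (henv : S.Environment P act ξ) (hK : 0 < K) (hT : 0 < S.T)
    (hq : ∀ k, 0 < S.q k) (hA : S.CombinationMatrix) (h : S.RiskAndLoss ν δ) (hδ : 0 < δ)
    (hν : 0 < ν) {wo : EuclideanSpace ℝ (Fin M)} (hopt : ∑ k, S.q k • S.riskGrad k wo = 0) :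
    ∃ μ₁ > 0, ∃ C > 0, ∀ μ, 0 < μ → μ < μ₁ → ∀ i,
      ∫ ω, ‖S.deviation wo μ (fun i k => act i k ω) (fun m k => ξ m k ω) ((i + 1) * S.T)‖ ^ 4 ∂P
        ≤ (1 - (∏ k, S.q k) * ν / 2 * μ)
          * ∫ ω, ‖S.deviation wo μ (fun i k => act i k ω) (fun m k => ξ m k ω) (i * S.T)‖ ^ 4 ∂P
          + C * μ ^ 3 := by
  have : Nonempty (Fin K) := ⟨⟨0, hK⟩⟩
  obtain ⟨G, hG0, hG⟩ := S.exists_norm_lossGrad_le wo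
  obtain ⟨c₀, hc₀, hAc⟩ := exists_norm_mix_sq_le (E := EuclideanSpace ℝ (Fin M))
    hA.mem_doublyStochastic (by ext i j; exact hA.symm j i) hA.primitive
  have hp : 0 < ∏ k, S.q k := Finset.prod_pos fun k _ => hq k
  obtain ⟨a, ha⟩ : ∃ a, a = S.T * δ := ⟨_, rfl⟩
  obtain ⟨r, hr⟩ : ∃ r, r = K * S.T * G := ⟨_, rfl⟩
  obtain ⟨b, hb⟩ : ∃ b, b = 12 * a * r + 4 * (K * S.T ^ 2 * δ * G) := ⟨_, rfl⟩
  obtain ⟨μ₁, hμ₁, C, hC, habs⟩ := fourth_moment_absorb hp hν hc₀ a b r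
  refine ⟨min μ₁ (min (1 / δ) (ν / δ ^ 2)), by positivity, C, hC, fun μ hμ hμlt i => ?_⟩
  have hμ1 : μ < μ₁ := hμlt.trans_le (min_le_left _ _)
  have hμδ : μ * δ ≤ 1 :=
    (le_div_iff₀ hδ).1 (hμlt.le.trans ((min_le_right _ _).trans (min_le_left _ _)))
  have hμδ2 : μ * δ ^ 2 ≤ ν :=
    (le_div_iff₀ (by positivity)).1
      (hμlt.le.trans ((min_le_right _ _).trans (min_le_right _ _)))
  set Y : Ω → PiLp 2 (fun _ : Fin K => EuclideanSpace ℝ (Fin M)) := fun ω =>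
    S.deviation wo μ (fun i k => act i k ω) (fun m k => ξ m k ω) (i * S.T) with hYdef
  have hY : FinitelyMeasurable (S.envSigma act ξ (S.past (i * S.T))) Y :=
    finitelyMeasurable_deviation wo μ _
  have hYm := hY.mono (henv.envSigma_le _)
  have hY1m := (finitelyMeasurable_deviation (act := act) (ξ := ξ) wo μ
    ((i + 1) * S.T)).mono (henv.envSigma_le _)
  have hactm : FinitelyMeasurable mΩ fun ω k => act i k ω := FinitelyMeasurable.pi fun k =>
    (finitelyMeasurable_act (ξ := ξ) (Set.mem_univ _)).mono (henv.envSigma_le _)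
  have hξm : ∀ n, FinitelyMeasurable mΩ fun ω k => ξ n k ω := fun n =>
    FinitelyMeasurable.pi fun k =>
      (finitelyMeasurable_sample (act := act) (Set.mem_univ _)).mono (henv.envSigma_le _)
  -- the blocks of the mean vector all agree, so it may be read off at one agent
  have hmean : ∀ (y : PiLp 2 (fun _ : Fin K => EuclideanSpace ℝ (Fin M))) k k',
      mix (meanMatrix (Fin K)) y k = mix (meanMatrix (Fin K)) y k' := fun y k k' => rfl
  set k₀ : Fin K := ⟨0, hK⟩
  set T₁ : Ω → ℝ := fun ω => (if ∀ k, act i k ω = true then 1 else 0) * (‖Y ω‖ ^ 2 * (‖Y ω‖ ^ 2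
    - ∑ k, ‖Y ω k - μ • (S.lossGrad k (ξ (i * S.T + 1) k ω) (wo + Y ω k)
      - S.lossGrad k (ξ (i * S.T + 1) k ω) wo)‖ ^ 2)) with hT₁
  set Q : Ω → ℝ := fun ω => ‖Y ω‖ ^ 2
    * (c₀ / 2 * ‖Y ω - mix (meanMatrix (Fin K)) (Y ω)‖ ^ 2
      - 4 * c₀ * a ^ 2 * μ ^ 2 * ‖Y ω‖ ^ 2) with hQ
  set T₂ : Ω → ℝ := fun ω => Q ω * (if ∀ k, act i k ω = true then 1 else 0) with hT₂
  set T₃ : Ω → ℝ := fun ω => ∑ k, ∑ j ∈ Finset.range S.T, (if act i k ω then μ else 0)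
    * inner ℝ (‖Y ω‖ ^ 2 • mix (meanMatrix (Fin K)) (Y ω) k₀)
      (S.lossGrad k (ξ (i * S.T + j + 1) k ω) wo) with hT₃
  set R : Ω → ℝ := fun ω => ‖Y ω‖ ^ 2 * (b * μ ^ 2 * ‖Y ω‖
    + 20 * r * μ * ‖Y ω - mix (meanMatrix (Fin K)) (Y ω)‖ + 8 * r ^ 2 * μ ^ 2)
    + 3 * r ^ 4 * μ ^ 4 with hR
  have i0 : Integrable (fun ω => ‖Y ω‖ ^ 4) P := (hYm.comp fun y => ‖y‖ ^ 4).integrable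
  have i1 : Integrable T₁ P := ((hYm.comp₂ hactm fun y α => (y, α)).comp₂ (hξm (i * S.T + 1))
    fun p x => (if ∀ k, p.2 k = true then 1 else 0) * (‖p.1‖ ^ 2 * (‖p.1‖ ^ 2
      - ∑ k, ‖p.1 k - μ • (S.lossGrad k (x k) (wo + p.1 k)
        - S.lossGrad k (x k) wo)‖ ^ 2))).integrable
  have hQY : FinitelyMeasurable (S.envSigma act ξ (S.past (i * S.T))) Q :=
    hY.comp fun y => ‖y‖ ^ 2 * (c₀ / 2 * ‖y - mix (meanMatrix (Fin K)) y‖ ^ 2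
      - 4 * c₀ * a ^ 2 * μ ^ 2 * ‖y‖ ^ 2)
  have iQ : Integrable Q P := (hQY.mono (henv.envSigma_le _)).integrable
  have i2 : Integrable T₂ P := ((hQY.mono (henv.envSigma_le _)).comp₂ hactm
    fun y α => y * (if ∀ k, α k = true then 1 else 0)).integrable
  have i3 : Integrable T₃ P := (FinitelyMeasurable.finset_sum fun k _ =>
    FinitelyMeasurable.finset_sum fun j _ => (hYm.comp₂ hactm fun y α => (y, α)).comp₂
      (hξm (i * S.T + j + 1)) fun p x => (if p.2 k then μ else 0)
        * inner ℝ (‖p.1‖ ^ 2 • mix (meanMatrix (Fin K)) p.1 k₀)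
          (S.lossGrad k (x k) wo)).integrable
  have i4 : Integrable R P := (hYm.comp fun y => ‖y‖ ^ 2 * (b * μ ^ 2 * ‖y‖
    + 20 * r * μ * ‖y - mix (meanMatrix (Fin K)) y‖ + 8 * r ^ 2 * μ ^ 2)
    + 3 * r ^ 4 * μ ^ 4).integrable
  have hpath : ∀ ω, ‖S.deviation wo μ (fun i k => act i k ω) (fun m k => ξ m k ω)
      ((i + 1) * S.T)‖ ^ 4 ≤ ‖Y ω‖ ^ 4 - T₁ ω - T₂ ω - 4 * T₃ ω + R ω := by
    intro ω
    have h1 := h.norm_deviation_pow_four_le (act := fun i k => act i k ω)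
      (ξ := fun m k => ξ m k ω) hδ hμ.le hμδ hA hT hG0 hG hc₀.le hAc ha hr hb i (Y := Y ω) rfl
    have h2 : T₃ ω = ‖Y ω‖ ^ 2 * ∑ k, ∑ j ∈ Finset.range S.T, (if act i k ω then μ else 0)
        * inner ℝ (mix (meanMatrix (Fin K)) (Y ω) k)
          (S.lossGrad k (ξ (i * S.T + j + 1) k ω) wo) := by
      simp only [hT₃, Finset.mul_sum, real_inner_smul_left]
      refine Finset.sum_congr rfl fun k _ => Finset.sum_congr rfl fun j _ => ?_
      rw [hmean (Y ω) k₀ k]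
      ring
    have h3 : T₂ ω = (if ∀ k, act i k ω = true then 1 else 0) * Q ω := mul_comm _ _
    rw [h2, h3]
    exact h1
  have e1 := henv.integral_contraction_ge (fun k => (hq k).le) h wo hμ.le hμδ2 i hY
  have e2 : ∫ ω, T₂ ω ∂P = (∏ k, S.q k) * ∫ ω, Q ω ∂P :=
    henv.integral_mul_allActive (fun k => (hq k).le) (act_notMem_past i) hQY
  have e3 : ∫ ω, T₃ ω ∂P = 0 :=
    henv.integral_drift_eq_zero (fun k => (hq k).le) h hopt μ i
      (hY.comp fun y => ‖y‖ ^ 2 • mix (meanMatrix (Fin K)) y k₀)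
  have hmono := integral_mono (hY1m.comp fun y => ‖y‖ ^ 4).integrable
    ((((i0.sub i1).sub i2).sub (i3.const_mul 4)).add i4) hpath
  have hexp : ∫ ω, (‖Y ω‖ ^ 4 - T₁ ω - T₂ ω - 4 * T₃ ω + R ω) ∂P
      = ∫ ω, ‖Y ω‖ ^ 4 ∂P - ∫ ω, T₁ ω ∂P - ∫ ω, T₂ ω ∂P - 4 * ∫ ω, T₃ ω ∂P + ∫ ω, R ω ∂P := by
    have j1 : Integrable (fun ω => ‖Y ω‖ ^ 4 - T₁ ω) P := i0.sub i1
    have j2 : Integrable (fun ω => ‖Y ω‖ ^ 4 - T₁ ω - T₂ ω) P := j1.sub i2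
    have j3 : Integrable (fun ω => ‖Y ω‖ ^ 4 - T₁ ω - T₂ ω - 4 * T₃ ω) P :=
      j2.sub (i3.const_mul 4)
    rw [integral_add j3 i4, integral_sub j2 (i3.const_mul 4), integral_sub j1 i2,
      integral_sub i0 i1, integral_const_mul]
  have hlast : ∫ ω, (‖Y ω‖ ^ 4 - (∏ k, S.q k) * (μ * ν * ‖Y ω‖ ^ 4) - (∏ k, S.q k) * Q ω
      + R ω) ∂P ≤ ∫ ω, ((1 - (∏ k, S.q k) * ν / 2 * μ) * ‖Y ω‖ ^ 4 + C * μ ^ 3) ∂P := by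
    refine integral_mono
      (((i0.sub ((i0.const_mul _).const_mul _)).sub (iQ.const_mul _)).add i4)
      ((i0.const_mul _).add (integrable_const _)) fun ω => ?_
    have := habs μ hμ hμ1 ‖Y ω‖ ‖Y ω - mix (meanMatrix (Fin K)) (Y ω)‖
    simp only [hQ, hR]
    linarith
  have hexp2 : ∫ ω, (‖Y ω‖ ^ 4 - (∏ k, S.q k) * (μ * ν * ‖Y ω‖ ^ 4) - (∏ k, S.q k) * Q ω
      + R ω) ∂P = ∫ ω, ‖Y ω‖ ^ 4 ∂P - (∏ k, S.q k) * (μ * ν * ∫ ω, ‖Y ω‖ ^ 4 ∂P)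
        - (∏ k, S.q k) * ∫ ω, Q ω ∂P + ∫ ω, R ω ∂P := by
    have j0 : Integrable (fun ω => (∏ k, S.q k) * (μ * ν * ‖Y ω‖ ^ 4)) P :=
      (i0.const_mul _).const_mul _
    have j1 : Integrable (fun ω => ‖Y ω‖ ^ 4 - (∏ k, S.q k) * (μ * ν * ‖Y ω‖ ^ 4)) P :=
      i0.sub j0
    have j2 : Integrable (fun ω => ‖Y ω‖ ^ 4 - (∏ k, S.q k) * (μ * ν * ‖Y ω‖ ^ 4)
        - (∏ k, S.q k) * Q ω) P := j1.sub (iQ.const_mul _)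
    rw [integral_add j2 i4, integral_sub j1 (iQ.const_mul _), integral_sub i0 j0,
      integral_const_mul, integral_const_mul, integral_const_mul]
  have hexp3 : ∫ ω, ((1 - (∏ k, S.q k) * ν / 2 * μ) * ‖Y ω‖ ^ 4 + C * μ ^ 3) ∂P
      = (1 - (∏ k, S.q k) * ν / 2 * μ) * ∫ ω, ‖Y ω‖ ^ 4 ∂P + C * μ ^ 3 := by
    rw [integral_add (i0.const_mul _) (integrable_const _), integral_const_mul]
    simp
  rw [hexp2, hexp3] at hlast
  refine hmono.trans ?_
  refine (le_of_eq hexp).trans ?_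
  rw [e2, e3]
  linarith

end Environment

end Setup

/-! ### Recursions and limits superior -/

lemma eventually_le_of_recursion {x : ℕ → ℝ} {a B : ℝ} (ha : 0 < a) (ha1 : a ≤ 1) (hB : 0 < B)
    (hx : ∀ᶠ i in atTop, x (i + 1) ≤ (1 - a) * x i + a * B) :
    ∀ᶠ i in atTop, x i ≤ 2 * B := by
  obtain ⟨i₀, hi₀⟩ := eventually_atTop.1 hx
  have h1 : ∀ n, x (n + i₀) - B ≤ (1 - a) ^ n * |x i₀ - B| := by
    intro n
    induction n with
    | zero => simpa using le_abs_self (x i₀ - B)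
    | succ n ih =>
      have h2 := hi₀ (n + i₀) (by omega)
      have h3 := mul_le_mul_of_nonneg_left ih (sub_nonneg.2 ha1)
      have e : n + 1 + i₀ = n + i₀ + 1 := by ring
      rw [e, pow_succ]
      linarith
  have h2 : Tendsto (fun n : ℕ => (1 - a) ^ n * |x i₀ - B|) atTop (nhds (0 * |x i₀ - B|)) :=
    (tendsto_pow_atTop_nhds_zero_of_lt_one (by linarith) (by linarith)).mul_const _
  rw [zero_mul] at h2
  have h3 := h2.eventually_le_const hB
  obtain ⟨n₀, hn₀⟩ := eventually_atTop.1 h3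
  filter_upwards [eventually_ge_atTop (n₀ + i₀)] with i hi
  have h4 := h1 (i - i₀)
  have h5 := hn₀ (i - i₀) (by omega)
  rw [Nat.sub_add_cancel (by omega)] at h4
  linarith

lemma limsup_ofReal_le_add {a b : ℕ → ℝ} {c : ℝ} (hb : ∀ i, 0 ≤ b i) (hc : 0 ≤ c)
    (hab : ∀ᶠ i in atTop, a i ≤ b i + c) :
    limsup (fun i => ENNReal.ofReal (a i)) atTop
      ≤ limsup (fun i => ENNReal.ofReal (b i)) atTop + ENNReal.ofReal c := by
  have h1 : limsup (fun i => ENNReal.ofReal (a i)) atTop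
      ≤ limsup (fun i => ENNReal.ofReal (b i) + ENNReal.ofReal c) atTop := by
    refine limsup_le_limsup (hab.mono fun i hi => ?_)
    exact (ENNReal.ofReal_le_ofReal hi).trans_eq (ENNReal.ofReal_add (hb i) hc)
  have h2 := limsup_add_const atTop (fun i => ENNReal.ofReal (b i)) (ENNReal.ofReal c)
    (by isBoundedDefault) (by isBoundedDefault)
  rwa [h2] at h1

lemma limsup_ofReal_ne_top {a : ℕ → ℝ} {A : ℝ} (ha : ∀ᶠ i in atTop, a i ≤ A) :
    limsup (fun i => ENNReal.ofReal (a i)) atTop ≠ ⊤ :=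
  ne_top_of_le_ne_top ENNReal.ofReal_ne_top
    (limsup_le_of_le (by isBoundedDefault) (ha.mono fun _ hi => ENNReal.ofReal_le_ofReal hi))

lemma abs_limsup_ofReal_sub_le {a b : ℕ → ℝ} {A B c : ℝ} (ha : ∀ i, 0 ≤ a i) (hb : ∀ i, 0 ≤ b i)
    (hc : 0 ≤ c) (haA : ∀ᶠ i in atTop, a i ≤ A) (hbB : ∀ᶠ i in atTop, b i ≤ B)
    (hab : ∀ᶠ i in atTop, |a i - b i| ≤ c) :
    |(limsup (fun i => ENNReal.ofReal (a i)) atTop).toReal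
      - (limsup (fun i => ENNReal.ofReal (b i)) atTop).toReal| ≤ c := by
  have hA := limsup_ofReal_ne_top haA
  have hB := limsup_ofReal_ne_top hbB
  have h1 := limsup_ofReal_le_add hb hc
    (hab.mono fun i hi => by linarith [(abs_le.1 hi).2] : ∀ᶠ i in atTop, a i ≤ b i + c)
  have h2 := limsup_ofReal_le_add ha hc
    (hab.mono fun i hi => by linarith [(abs_le.1 hi).1] : ∀ᶠ i in atTop, b i ≤ a i + c)
  have h3 := ENNReal.toReal_mono (ENNReal.add_ne_top.2 ⟨hB, ENNReal.ofReal_ne_top⟩) h1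
  have h4 := ENNReal.toReal_mono (ENNReal.add_ne_top.2 ⟨hA, ENNReal.ofReal_ne_top⟩) h2
  rw [ENNReal.toReal_add hB ENNReal.ofReal_ne_top, ENNReal.toReal_ofReal hc] at h3
  rw [ENNReal.toReal_add hA ENNReal.ofReal_ne_top, ENNReal.toReal_ofReal hc] at h4
  rw [abs_le]
  constructor <;> linarith

lemma meanSquare_eq_ofReal {K M : ℕ} {Ω : Type*} [mΩ : MeasurableSpace Ω] {P : Measure Ω}
    [IsProbabilityMeasure P] {X : Ω → Fin K → EuclideanSpace ℝ (Fin M)}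
    (hX : FinitelyMeasurable mΩ X) :
    meanSquare P X = ENNReal.ofReal (∫ ω, ‖(WithLp.toLp 2 (X ω) :
      PiLp 2 (fun _ : Fin K => EuclideanSpace ℝ (Fin M)))‖ ^ 2 ∂P) := by
  rw [ofReal_integral_eq_lintegral_ofReal (hX.comp fun x => ‖(WithLp.toLp 2 x :
      PiLp 2 (fun _ : Fin K => EuclideanSpace ℝ (Fin M)))‖ ^ 2).integrable
    (Eventually.of_forall fun ω => by positivity)]
  refine lintegral_congr fun ω => ?_
  rw [PiLp.norm_sq_eq_of_L2, ENNReal.ofReal_sum_of_nonneg fun k _ => by positivity]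

namespace Setup

variable {K M : ℕ} {𝒳 : Type*} {S : Setup K M 𝒳} {ν δ : ℝ}
variable {Ω : Type*} {act : ℕ → Fin K → Ω → Bool} {ξ : ℕ → (k : Fin K) → Ω → Fin (S.N k)}

namespace Environment

variable [mΩ : MeasurableSpace Ω] {P : Measure Ω} [IsProbabilityMeasure P]

/-! ### Steady-state bounds -/

lemma sq_le_of_le_add {z x d e s : ℝ} (hz : 0 ≤ z) (hx0 : 0 ≤ x) (hx1 : x ≤ 1) (hs : 0 < s)
    (h : z ≤ (1 - x) * d + e) :
    z ^ 2 ≤ (1 + s) * ((1 - x) * d ^ 2) + (1 + 1 / s) * e ^ 2 := by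
  have h1 := pow_le_pow_left₀ hz h 2
  have h2 : (1 + s) * ((1 - x) * d) ^ 2 + (1 + 1 / s) * e ^ 2 - ((1 - x) * d + e) ^ 2
      = (s * ((1 - x) * d) - e) ^ 2 / s := by field_simp; ring
  have h3 : 0 ≤ (s * ((1 - x) * d) - e) ^ 2 / s := by positivity
  have h4 : ((1 - x) * d) ^ 2 ≤ (1 - x) * d ^ 2 := by
    have h5 : 0 ≤ x * (1 - x) * d ^ 2 :=
      mul_nonneg (mul_nonneg hx0 (sub_nonneg.2 hx1)) (sq_nonneg d)
    linarith
  have h6 := mul_le_mul_of_nonneg_left h4 (show 0 ≤ 1 + s by positivity)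
  linarith

lemma sq_forcing_le {η μ y r T C : ℝ} (hη : 0 < η) (hμ : 0 < μ) (hμ1 : μ ≤ 1) (hy : 0 ≤ y)
    (hr : 0 ≤ r) :
    (1 + 1 / (η * μ)) * (T * (μ * (C * (y + r * μ) ^ 2))) ^ 2
      ≤ (1 + 1 / η) * (T ^ 2 * C ^ 2 * 8 * (1 + r ^ 4)) * μ * (y ^ 4 + μ ^ 4) := by
  have h1 : (y + r * μ) ^ 4 ≤ 8 * (y ^ 4 + (r * μ) ^ 4) := by
    have := add_pow_le hy (mul_nonneg hr hμ.le) 4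
    norm_num at this
    exact this
  have h2 : y ^ 4 + (r * μ) ^ 4 ≤ (1 + r ^ 4) * (y ^ 4 + μ ^ 4) := by
    have h3 : 0 ≤ r ^ 4 * y ^ 4 := by positivity
    have h4 : 0 ≤ μ ^ 4 := by positivity
    rw [mul_pow]
    linarith
  have h3 : (1 + 1 / (η * μ)) * μ ^ 2 ≤ (1 + 1 / η) * μ := by
    have e1 : (1 + 1 / (η * μ)) * μ ^ 2 = μ * μ + 1 / η * μ := by field_simp
    have h4 := mul_le_mul_of_nonneg_right hμ1 hμ.le
    linarith
  calc (1 + 1 / (η * μ)) * (T * (μ * (C * (y + r * μ) ^ 2))) ^ 2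
      = (1 + 1 / (η * μ)) * μ ^ 2 * (T ^ 2 * C ^ 2) * (y + r * μ) ^ 4 := by ring
    _ ≤ (1 + 1 / η) * μ * (T ^ 2 * C ^ 2) * (8 * ((1 + r ^ 4) * (y ^ 4 + μ ^ 4))) := by
        have h5 := h1.trans (mul_le_mul_of_nonneg_left h2 (by norm_num : (0 : ℝ) ≤ 8))
        gcongr
    _ = _ := by ring

/-- The mean-square gap at the end of a block, and inside it, is controlled by the gap and by the
fourth moment of the deviation at its start. -/
lemma exists_gap_moment_le (henv : S.Environment P act ξ) (hT : 0 < S.T)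
    (hq : ∀ k, 0 < S.q k) (hA : S.CombinationMatrix) (h : S.RiskAndLoss ν δ) (hδ : 0 < δ)
    (hν : 0 < ν) {wo : EuclideanSpace ℝ (Fin M)} (hH : S.SmoothHessians wo)
    (v₀ : Fin K → EuclideanSpace ℝ (Fin M)) :
    ∃ μ₁ > 0, ∃ C > 0, ∀ μ, 0 < μ → μ < μ₁ → ∀ i t, 1 ≤ t → t ≤ S.T →
      ∫ ω, ‖S.longTermGap wo v₀ μ (fun i k => act i k ω) (fun m k => ξ m k ω)
          (i * S.T + t)‖ ^ 2 ∂P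
        ≤ (1 - (∏ k, S.q k) * ν / 4 * μ)
          * ∫ ω, ‖S.longTermGap wo v₀ μ (fun i k => act i k ω) (fun m k => ξ m k ω)
              (i * S.T)‖ ^ 2 ∂P
          + C * μ * (∫ ω, ‖S.deviation wo μ (fun i k => act i k ω) (fun m k => ξ m k ω)
              (i * S.T)‖ ^ 4 ∂P + μ ^ 4) := by
  obtain ⟨G, hG0, hG⟩ := S.exists_norm_lossGrad_le wo
  obtain ⟨C₂, hC₂, hquad⟩ := h.exists_norm_riskGrad_sub_le hδ.le hH
  have hp : 0 < ∏ k, S.q k := Finset.prod_pos fun k _ => hq k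
  set p := ∏ k, S.q k with hpdef
  obtain ⟨r, hr⟩ : ∃ r, r = K * S.T * G := ⟨_, rfl⟩
  obtain ⟨η, hη⟩ : ∃ η, η = p * ν / 4 := ⟨_, rfl⟩
  have hη0 : 0 < η := by rw [hη]; positivity
  have hT' : (0 : ℝ) < S.T := by exact_mod_cast hT
  have hr0 : 0 ≤ r := by rw [hr]; positivity
  refine ⟨min 1 (min (1 / δ) (min (ν / δ ^ 2) (1 / ν))), by positivity,
    (1 + 1 / η) * (S.T ^ 2 * C₂ ^ 2 * 8 * (1 + r ^ 4)), by positivity,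
    fun μ hμ hμlt i t ht1 ht => ?_⟩
  have hμ1 : μ ≤ 1 := hμlt.le.trans (min_le_left _ _)
  have hμδ : μ * δ ≤ 1 :=
    (le_div_iff₀ hδ).1 (hμlt.le.trans ((min_le_right _ _).trans (min_le_left _ _)))
  have hμδ2 : μ * δ ^ 2 ≤ ν := (le_div_iff₀ (by positivity)).1 (hμlt.le.trans
    ((min_le_right _ _).trans ((min_le_right _ _).trans (min_le_left _ _))))
  have hμν : μ * ν ≤ 1 := (le_div_iff₀ hν).1 (hμlt.le.trans
    ((min_le_right _ _).trans ((min_le_right _ _).trans (min_le_right _ _))))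
  set D : ℕ → Ω → PiLp 2 (fun _ : Fin K => EuclideanSpace ℝ (Fin M)) := fun n ω =>
    S.longTermGap wo v₀ μ (fun i k => act i k ω) (fun m k => ξ m k ω) n with hD
  set Y : Ω → PiLp 2 (fun _ : Fin K => EuclideanSpace ℝ (Fin M)) := fun ω =>
    S.deviation wo μ (fun i k => act i k ω) (fun m k => ξ m k ω) (i * S.T) with hY
  have hDp : FinitelyMeasurable (S.envSigma act ξ (S.past (i * S.T))) (D (i * S.T)) :=
    finitelyMeasurable_longTermGap wo v₀ μ _
  have hDm : ∀ n, FinitelyMeasurable mΩ (D n) := fun n =>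
    (finitelyMeasurable_longTermGap wo v₀ μ _).mono (henv.envSigma_le _)
  have hYm : FinitelyMeasurable mΩ Y :=
    (finitelyMeasurable_deviation wo μ _).mono (henv.envSigma_le _)
  have hactm : FinitelyMeasurable mΩ fun ω k => act i k ω := FinitelyMeasurable.pi fun k =>
    (finitelyMeasurable_act (ξ := ξ) (Set.mem_univ _)).mono (henv.envSigma_le _)
  set c := S.T ^ 2 * C₂ ^ 2 * 8 * (1 + r ^ 4) with hc
  have hpath : ∀ ω, ‖D (i * S.T + t) ω‖ ^ 2
      ≤ (1 + η * μ) * ‖D (i * S.T) ω‖ ^ 2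
        - (1 + η * μ) * (μ * ν / 2) * (‖D (i * S.T) ω‖ ^ 2
          * (if ∀ k, act i k ω = true then 1 else 0))
        + (1 + 1 / η) * c * μ * (‖Y ω‖ ^ 4 + μ ^ 4) := by
    intro ω
    have h1 := h.norm_longTermGap_block_le (v₀ := v₀) (act := fun i k => act i k ω)
      (ξ := fun m k => ξ m k ω) hδ hν.le hA hμ.le hμδ2 hμν hC₂.le hquad i
      (Ymax := ‖Y ω‖ + r * μ)
      (fun t ht => hr ▸ h.norm_deviation_le hδ hμ.le hμδ hA hT hG0 hG i ht.le) ht1 ht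
    set d := ‖D (i * S.T) ω‖ with hd
    set y := ‖Y ω‖ with hy
    set χ : ℝ := if ∀ k, act i k ω = true then 1 else 0 with hχ
    have hχ0 : 0 ≤ χ := by rw [hχ]; split_ifs <;> norm_num
    have hχ1 : χ ≤ 1 := by rw [hχ]; split_ifs <;> norm_num
    have hμν0 : 0 ≤ μ * ν := by positivity
    have hx0 : 0 ≤ χ * (μ * ν / 2) := by positivity
    have hx1 : χ * (μ * ν / 2) ≤ 1 := by nlinarith
    set x := χ * (μ * ν / 2) with hx
    set e := S.T * (μ * (C₂ * (y + r * μ) ^ 2)) with he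
    have hy0 : 0 ≤ y := norm_nonneg _
    have hd0 : 0 ≤ d := norm_nonneg _
    have he0 : 0 ≤ e := by positivity
    have h2 : ‖D (i * S.T + t) ω‖ ≤ (1 - x) * d + e := by
      refine h1.trans (add_le_add le_rfl ?_)
      rw [he]
      have : (t : ℝ) ≤ S.T := by exact_mod_cast ht
      gcongr
    have h3 := sq_le_of_le_add (norm_nonneg _) hx0 hx1 (mul_pos hη0 hμ) h2
    have h4 : (1 + 1 / (η * μ)) * e ^ 2 ≤ (1 + 1 / η) * c * μ * (y ^ 4 + μ ^ 4) :=
      sq_forcing_le hη0 hμ hμ1 hy0 hr0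
    rw [hx] at h3
    linarith
  have i1 : Integrable (fun ω => ‖D (i * S.T) ω‖ ^ 2) P :=
    ((hDm _).comp fun x => ‖x‖ ^ 2).integrable
  have i2 : Integrable (fun ω => ‖D (i * S.T) ω‖ ^ 2
      * (if ∀ k, act i k ω = true then 1 else 0)) P :=
    ((hDm _).comp₂ hactm fun x α => ‖x‖ ^ 2 * (if ∀ k, α k = true then 1 else 0)).integrable
  have i3 : Integrable (fun ω => ‖Y ω‖ ^ 4) P := (hYm.comp fun y => ‖y‖ ^ 4).integrable
  have i4 : Integrable (fun ω => (1 + 1 / η) * c * μ * (‖Y ω‖ ^ 4 + μ ^ 4)) P :=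
    (i3.add (integrable_const _)).const_mul _
  have i5 : Integrable (fun ω => (1 + η * μ) * ‖D (i * S.T) ω‖ ^ 2
        - (1 + η * μ) * (μ * ν / 2) * (‖D (i * S.T) ω‖ ^ 2
          * (if ∀ k, act i k ω = true then 1 else 0))) P :=
    (i1.const_mul _).sub (i2.const_mul _)
  have hmono := integral_mono ((hDm (i * S.T + t)).comp fun x => ‖x‖ ^ 2).integrable
    (i5.add i4) hpath
  have hexp : ∫ ω, ((1 + η * μ) * ‖D (i * S.T) ω‖ ^ 2
        - (1 + η * μ) * (μ * ν / 2) * (‖D (i * S.T) ω‖ ^ 2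
          * (if ∀ k, act i k ω = true then 1 else 0))
        + (1 + 1 / η) * c * μ * (‖Y ω‖ ^ 4 + μ ^ 4)) ∂P
      = (1 + η * μ) * ∫ ω, ‖D (i * S.T) ω‖ ^ 2 ∂P
        - (1 + η * μ) * (μ * ν / 2) * (p * ∫ ω, ‖D (i * S.T) ω‖ ^ 2 ∂P)
        + (1 + 1 / η) * c * μ * (∫ ω, ‖Y ω‖ ^ 4 ∂P + μ ^ 4) := by
    rw [integral_add i5 i4, integral_sub (i1.const_mul _) (i2.const_mul _), integral_const_mul,
      integral_const_mul, integral_const_mul, integral_add i3 (integrable_const _),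
      henv.integral_mul_allActive (fun k => (hq k).le) (act_notMem_past i)
        (hDp.comp fun x => ‖x‖ ^ 2), ← hpdef]
    simp
  refine hmono.trans ((le_of_eq hexp).trans ?_)
  have hg0 : 0 ≤ ∫ ω, ‖D (i * S.T) ω‖ ^ 2 ∂P := integral_nonneg fun ω => by positivity
  set g := ∫ ω, ‖D (i * S.T) ω‖ ^ 2 ∂P with hg
  have h12 : (1 + η * μ) * g - (1 + η * μ) * (μ * ν / 2) * (p * g)
      = (1 - p * ν / 4 * μ) * g - 2 * (η * μ) ^ 2 * g := by rw [hη]; ring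
  have h13 : 0 ≤ 2 * (η * μ) ^ 2 * g := by positivity
  linarith

end Environment

end Setup

namespace Setup

variable {K M : ℕ} {𝒳 : Type*} {S : Setup K M 𝒳} {ν δ : ℝ}
variable {Ω : Type*} {act : ℕ → Fin K → Ω → Bool} {ξ : ℕ → (k : Fin K) → Ω → Fin (S.N k)}

namespace Environment

variable [mΩ : MeasurableSpace Ω] {P : Measure Ω} [IsProbabilityMeasure P]

/-- In the steady state, the fourth moment of the deviation and the mean-square gap are both of
order `μ ^ 2`, at every position in a block. -/
lemma exists_steady_state_le (henv : S.Environment P act ξ) (hK : 0 < K) (hT : 0 < S.T)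
    (hq : ∀ k, 0 < S.q k) (hA : S.CombinationMatrix) (h : S.RiskAndLoss ν δ) (hδ : 0 < δ)
    (hν : 0 < ν) {wo : EuclideanSpace ℝ (Fin M)} (hopt : ∑ k, S.q k • S.riskGrad k wo = 0)
    (hH : S.SmoothHessians wo) (v₀ : Fin K → EuclideanSpace ℝ (Fin M)) :
    ∃ μ₁ > 0, ∃ C > 0, ∀ μ, 0 < μ → μ < μ₁ → ∀ t, 1 ≤ t → t ≤ S.T → ∀ᶠ i in atTop,
      ∫ ω, ‖S.deviation wo μ (fun i k => act i k ω) (fun m k => ξ m k ω) (i * S.T + t)‖ ^ 4 ∂P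
        ≤ C * μ ^ 2 ∧
      ∫ ω, ‖S.longTermGap wo v₀ μ (fun i k => act i k ω) (fun m k => ξ m k ω)
        (i * S.T + t)‖ ^ 2 ∂P ≤ C * μ ^ 2 := by
  obtain ⟨G, hG0, hG⟩ := S.exists_norm_lossGrad_le wo
  obtain ⟨μ₁, hμ₁, C₁, hC₁, hfourth⟩ := henv.exists_fourth_moment_le hK hT hq hA h hδ hν hopt
  obtain ⟨μ₂, hμ₂, C₂, hC₂, hgap⟩ := henv.exists_gap_moment_le hT hq hA h hδ hν hH v₀
  have hp : 0 < ∏ k, S.q k := Finset.prod_pos fun k _ => hq k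
  set p := ∏ k, S.q k
  obtain ⟨r, hr⟩ : ∃ r, r = K * S.T * G := ⟨_, rfl⟩
  obtain ⟨a, ha⟩ : ∃ a, a = p * ν / 4 := ⟨_, rfl⟩
  have ha0 : 0 < a := by rw [ha]; positivity
  have hr0 : 0 ≤ r := by rw [hr]; positivity
  -- steady-state constants of the fourth moment and of the gap at the starts of the blocks
  obtain ⟨B₁, hB₁⟩ : ∃ B, B = 2 * (C₁ / (2 * a)) := ⟨_, rfl⟩
  obtain ⟨B₂, hB₂⟩ : ∃ B, B = 2 * (C₂ * (B₁ + 1) / a) := ⟨_, rfl⟩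
  have hB₁0 : 0 < B₁ := by rw [hB₁]; positivity
  have hB₂0 : 0 < B₂ := by rw [hB₂]; positivity
  refine ⟨min (min μ₁ μ₂) (min (min 1 (1 / δ)) (1 / (2 * a))), by positivity,
    8 * (B₁ + r ^ 4) + B₂ + C₂ * (B₁ + 1), by positivity, fun μ hμ hμlt t ht1 ht => ?_⟩
  have hμ1 : μ < μ₁ := hμlt.trans_le ((min_le_left _ _).trans (min_le_left _ _))
  have hμ2 : μ < μ₂ := hμlt.trans_le ((min_le_left _ _).trans (min_le_right _ _))
  have hμone : μ ≤ 1 :=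
    hμlt.le.trans ((min_le_right _ _).trans ((min_le_left _ _).trans (min_le_left _ _)))
  have hμδ : μ * δ ≤ 1 := (le_div_iff₀ hδ).1
    (hμlt.le.trans ((min_le_right _ _).trans ((min_le_left _ _).trans (min_le_right _ _))))
  have hμa : μ * (2 * a) ≤ 1 := (le_div_iff₀ (by positivity)).1
    (hμlt.le.trans ((min_le_right _ _).trans (min_le_right _ _)))
  have haμ : 0 < a * μ := by positivity
  have hpow2 : 0 < μ ^ 2 := by positivity
  have hpow4 : μ ^ 4 ≤ μ ^ 2 := pow_le_pow_of_le_one hμ.le hμone (by norm_num)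
  have hpow3 : μ ^ 3 ≤ μ ^ 2 := pow_le_pow_of_le_one hμ.le hμone (by norm_num)
  set Y : ℕ → Ω → PiLp 2 (fun _ : Fin K => EuclideanSpace ℝ (Fin M)) := fun n ω =>
    S.deviation wo μ (fun i k => act i k ω) (fun m k => ξ m k ω) n with hY
  set D : ℕ → Ω → PiLp 2 (fun _ : Fin K => EuclideanSpace ℝ (Fin M)) := fun n ω =>
    S.longTermGap wo v₀ μ (fun i k => act i k ω) (fun m k => ξ m k ω) n with hD
  have hYm : ∀ n, FinitelyMeasurable mΩ (Y n) := fun n =>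
    (finitelyMeasurable_deviation wo μ _).mono (henv.envSigma_le _)
  have hy : ∀ᶠ i in atTop, ∫ ω, ‖Y (i * S.T) ω‖ ^ 4 ∂P ≤ B₁ * μ ^ 2 := by
    have h1 := eventually_le_of_recursion (x := fun i => ∫ ω, ‖Y (i * S.T) ω‖ ^ 4 ∂P)
      (a := 2 * a * μ) (B := C₁ / (2 * a) * μ ^ 2) (by positivity) (by linarith) (by positivity)
      (Eventually.of_forall fun i => by
        refine (hfourth μ hμ hμ1 i).trans (le_of_eq ?_)
        rw [ha]
        field_simp
        ring)
    filter_upwards [h1] with i hi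
    rw [hB₁]
    linarith
  have hforce : ∀ᶠ i in atTop,
      C₂ * μ * (∫ ω, ‖Y (i * S.T) ω‖ ^ 4 ∂P + μ ^ 4) ≤ C₂ * (B₁ + 1) * μ ^ 3 := by
    filter_upwards [hy] with i hi
    have h1 : ∫ ω, ‖Y (i * S.T) ω‖ ^ 4 ∂P + μ ^ 4 ≤ (B₁ + 1) * μ ^ 2 := by linarith
    calc _ ≤ C₂ * μ * ((B₁ + 1) * μ ^ 2) := by gcongr
      _ = _ := by ring
  have hg : ∀ᶠ i in atTop, ∫ ω, ‖D (i * S.T) ω‖ ^ 2 ∂P ≤ B₂ * μ ^ 2 := by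
    have h1 := eventually_le_of_recursion (x := fun i => ∫ ω, ‖D (i * S.T) ω‖ ^ 2 ∂P)
      (a := a * μ) (B := C₂ * (B₁ + 1) / a * μ ^ 2) haμ (by linarith) (by positivity)
      (by
        filter_upwards [hforce] with i hi
        have h2 := hgap μ hμ hμ2 i S.T hT le_rfl
        have e : i * S.T + S.T = (i + 1) * S.T := by ring
        have e2 : a * μ * (C₂ * (B₁ + 1) / a * μ ^ 2) = C₂ * (B₁ + 1) * μ ^ 3 := by
          field_simp
        rw [e, ← ha] at h2
        rw [e2]
        exact h2.trans (add_le_add le_rfl hi))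
    filter_upwards [h1] with i hi
    rw [hB₂]
    linarith
  filter_upwards [hy, hg, hforce] with i hyi hgi hfi
  constructor
  · have h1 : ∫ ω, ‖Y (i * S.T + t) ω‖ ^ 4 ∂P
        ≤ ∫ ω, (8 * (‖Y (i * S.T) ω‖ ^ 4 + (r * μ) ^ 4)) ∂P := by
      refine integral_mono ((hYm _).comp fun y => ‖y‖ ^ 4).integrable
        ((hYm (i * S.T)).comp fun y => 8 * (‖y‖ ^ 4 + (r * μ) ^ 4)).integrable fun ω => ?_
      have h2 : ‖Y (i * S.T + t) ω‖ ≤ ‖Y (i * S.T) ω‖ + r * μ :=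
        hr ▸ h.norm_deviation_le hδ hμ.le hμδ hA hT hG0 hG i ht
      have h3 := add_pow_le (norm_nonneg (Y (i * S.T) ω)) (mul_nonneg hr0 hμ.le) 4
      norm_num at h3
      exact (pow_le_pow_left₀ (norm_nonneg _) h2 4).trans h3
    rw [integral_const_mul, integral_add ((hYm _).comp fun y => ‖y‖ ^ 4).integrable
      (integrable_const _)] at h1
    simp only [integral_const, probReal_univ, one_smul] at h1
    have h4 : (r * μ) ^ 4 ≤ r ^ 4 * μ ^ 2 := by rw [mul_pow]; gcongr
    have h5 : 0 ≤ (B₂ + C₂ * (B₁ + 1)) * μ ^ 2 := by positivity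
    linarith
  · have h1 := hgap μ hμ hμ2 i t ht1 ht
    rw [← ha] at h1
    have h2 : 0 ≤ ∫ ω, ‖D (i * S.T) ω‖ ^ 2 ∂P := integral_nonneg fun ω => by positivity
    have h3 : 0 ≤ a * μ * ∫ ω, ‖D (i * S.T) ω‖ ^ 2 ∂P := mul_nonneg haμ.le h2
    have h4 : C₂ * (B₁ + 1) * μ ^ 3 ≤ C₂ * (B₁ + 1) * μ ^ 2 := by gcongr
    have h5 : 0 ≤ 8 * (B₁ + r ^ 4) * μ ^ 2 := by positivity
    change ∫ ω, ‖D (i * S.T + t) ω‖ ^ 2 ∂P ≤ _ at h1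
    change _ ≤ (1 - a * μ) * ∫ ω, ‖D (i * S.T) ω‖ ^ 2 ∂P
      + C₂ * μ * (∫ ω, ‖Y (i * S.T) ω‖ ^ 4 ∂P + μ ^ 4) at h1
    linarith

end Environment

end Setup

/-- Two random vectors with close second moments: if `X` has fourth moment of order `μ ^ 2` and
`X - X'` has second moment of order `μ ^ 2`, the second moments are of order `μ` and differ by
`O(μ ^ (3 / 2))`.  Young's inequality with the weights `μ` and `√μ` replaces the inequalities of
Jensen and of Cauchy and Schwarz. -/
lemma second_moments_close {H Ω : Type*} [NormedAddCommGroup H] [InnerProductSpace ℝ H]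
    [mΩ : MeasurableSpace Ω] {P : Measure Ω} [IsProbabilityMeasure P] {X X' : Ω → H}
    (hX : FinitelyMeasurable mΩ X) (hX' : FinitelyMeasurable mΩ X') {μ C : ℝ} (hμ : 0 < μ)
    (hμ1 : μ ≤ 1) (hC : 0 ≤ C) (h4 : ∫ ω, ‖X ω‖ ^ 4 ∂P ≤ C * μ ^ 2)
    (h2 : ∫ ω, ‖X ω - X' ω‖ ^ 2 ∂P ≤ C * μ ^ 2) :
    ∫ ω, ‖X ω‖ ^ 2 ∂P ≤ (C + 1) * μ ∧
      |∫ ω, ‖X ω‖ ^ 2 ∂P - ∫ ω, ‖X' ω‖ ^ 2 ∂P| ≤ (3 * C + 1) * μ ^ (3 / 2 : ℝ) := by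
  have i2 : Integrable (fun ω => ‖X ω‖ ^ 2) P := (hX.comp fun x => ‖x‖ ^ 2).integrable
  have i2' : Integrable (fun ω => ‖X' ω‖ ^ 2) P := (hX'.comp fun x => ‖x‖ ^ 2).integrable
  have i4 : Integrable (fun ω => ‖X ω‖ ^ 4) P := (hX.comp fun x => ‖x‖ ^ 4).integrable
  have iD : Integrable (fun ω => ‖X ω - X' ω‖ ^ 2) P :=
    (hX.comp₂ hX' fun x y => ‖x - y‖ ^ 2).integrable
  have hm : ∫ ω, ‖X ω‖ ^ 2 ∂P ≤ (C + 1) * μ := by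
    have h5 : ∫ ω, ‖X ω‖ ^ 2 ∂P ≤ ∫ ω, (μ + 1 / μ * ‖X ω‖ ^ 4) ∂P := by
      refine integral_mono i2 ((integrable_const _).add (i4.const_mul _)) fun ω => ?_
      have e : μ + 1 / μ * ‖X ω‖ ^ 4 - ‖X ω‖ ^ 2
          = ((μ - ‖X ω‖ ^ 2 / 2) ^ 2 + 3 / 4 * ‖X ω‖ ^ 4) / μ := by field_simp; ring
      have : 0 ≤ ((μ - ‖X ω‖ ^ 2 / 2) ^ 2 + 3 / 4 * ‖X ω‖ ^ 4) / μ := by positivity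
      simp only
      linarith
    rw [integral_add (integrable_const _) (i4.const_mul _), integral_const_mul] at h5
    simp only [integral_const, probReal_univ, one_smul] at h5
    have h6 : 1 / μ * ∫ ω, ‖X ω‖ ^ 4 ∂P ≤ 1 / μ * (C * μ ^ 2) := by gcongr
    have e : 1 / μ * (C * μ ^ 2) = C * μ := by field_simp
    linarith
  refine ⟨hm, ?_⟩
  set s := Real.sqrt μ with hs
  have hs0 : 0 < s := Real.sqrt_pos.2 hμ
  have hss : s ^ 2 = μ := Real.sq_sqrt hμ.le
  have hs1 : s ≤ 1 := by rw [hs]; exact Real.sqrt_le_one.2 hμ1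
  have hpow : μ ^ (3 / 2 : ℝ) = s ^ 3 := by
    rw [hs, Real.sqrt_eq_rpow, ← Real.rpow_natCast, ← Real.rpow_mul hμ.le]
    norm_num
  have hpt : ∀ ω, |‖X ω‖ ^ 2 - ‖X' ω‖ ^ 2|
      ≤ s * ‖X ω‖ ^ 2 + 1 / s * ‖X ω - X' ω‖ ^ 2 + ‖X ω - X' ω‖ ^ 2 := by
    intro ω
    have e1 : ‖X' ω‖ ^ 2 = ‖X ω‖ ^ 2 - 2 * inner ℝ (X ω) (X ω - X' ω) + ‖X ω - X' ω‖ ^ 2 := by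
      rw [← norm_sub_sq_real, sub_sub_cancel]
    have e2 := abs_le.1 (abs_real_inner_le_norm (X ω) (X ω - X' ω))
    have e3 : 2 * (‖X ω‖ * ‖X ω - X' ω‖) ≤ s * ‖X ω‖ ^ 2 + 1 / s * ‖X ω - X' ω‖ ^ 2 := by
      have e : s * ‖X ω‖ ^ 2 + 1 / s * ‖X ω - X' ω‖ ^ 2 - 2 * (‖X ω‖ * ‖X ω - X' ω‖)
          = (s * ‖X ω‖ - ‖X ω - X' ω‖) ^ 2 / s := by field_simp; ring
      have : 0 ≤ (s * ‖X ω‖ - ‖X ω - X' ω‖) ^ 2 / s := by positivity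
      linarith
    have e4 := sq_nonneg ‖X ω - X' ω‖
    rw [abs_le]
    constructor <;> linarith [e2.1, e2.2]
  have j1 : Integrable (fun ω => s * ‖X ω‖ ^ 2 + 1 / s * ‖X ω - X' ω‖ ^ 2) P :=
    (i2.const_mul _).add (iD.const_mul _)
  rw [← integral_sub i2 i2']
  refine (abs_integral_le_integral_abs).trans
    ((integral_mono (i2.sub i2').abs (j1.add iD) hpt).trans ?_)
  have hexp : ∫ ω, (s * ‖X ω‖ ^ 2 + 1 / s * ‖X ω - X' ω‖ ^ 2 + ‖X ω - X' ω‖ ^ 2) ∂P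
      = s * ∫ ω, ‖X ω‖ ^ 2 ∂P + 1 / s * ∫ ω, ‖X ω - X' ω‖ ^ 2 ∂P
        + ∫ ω, ‖X ω - X' ω‖ ^ 2 ∂P := by
    rw [integral_add j1 iD, integral_add (i2.const_mul _) (iD.const_mul _), integral_const_mul,
      integral_const_mul]
  refine (le_of_eq hexp).trans ?_
  rw [← hss] at hm h2
  have k1 : s * ∫ ω, ‖X ω‖ ^ 2 ∂P ≤ s * ((C + 1) * s ^ 2) := by gcongr
  have k2 : 1 / s * ∫ ω, ‖X ω - X' ω‖ ^ 2 ∂P ≤ 1 / s * (C * (s ^ 2) ^ 2) := by gcongr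
  have k3 : 1 / s * (C * (s ^ 2) ^ 2) = C * s ^ 3 := by field_simp
  have k4 : C * (s ^ 2) ^ 2 ≤ C * s ^ 3 := by
    rw [← pow_mul]
    have := pow_le_pow_of_le_one hs0.le hs1 (show 3 ≤ 2 * 2 by norm_num)
    gcongr
  rw [hpow]
  linarith

end DiffusionLearning

theorem theorem3 {K M : ℕ} {𝒳 : Type*} (S : DiffusionLearning.Setup K M 𝒳) (hK : 0 < K)
    (hT : 0 < S.T) (hq : ∀ k, 0 < S.q k ∧ S.q k ≤ 1)
    (hA : S.CombinationMatrix)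
    (ν δ : ℝ) (hν : 0 < ν) (hJQ : S.RiskAndLoss ν δ)
    (wo : EuclideanSpace ℝ (Fin M)) (hwo : IsMinOn S.weightedRisk Set.univ wo)
    (hHess : S.SmoothHessians wo)
    {Ω : Type*} [MeasurableSpace Ω] (P : MeasureTheory.Measure Ω)
    [MeasureTheory.IsProbabilityMeasure P]
    (act : ℕ → Fin K → Ω → Bool) (ξ : ℕ → (k : Fin K) → Ω → Fin (S.N k))
    (henv : S.Environment P act ξ)
    (v₀ : Fin K → EuclideanSpace ℝ (Fin M))
    (W W' : ℝ → ℕ → Ω → Fin K → EuclideanSpace ℝ (Fin M))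
    (hW : ∀ μ n ω, W μ n ω = S.error wo μ (fun i k => act i k ω) (fun m k => ξ m k ω) n)
    (hW' : ∀ μ n ω,
      W' μ n ω = S.longTerm wo v₀ μ (fun i k => act i k ω) (fun m k => ξ m k ω) n) :
    ∃ μ₀ > 0, ∃ C > 0, ∀ μ : ℝ, 0 < μ → μ < μ₀ → ∀ t : ℕ, 1 ≤ t → t ≤ S.T →
      Filter.limsup (fun i : ℕ => DiffusionLearning.meanSquare P
          (fun ω => W μ (i * S.T + t) ω - W' μ (i * S.T + t) ω)) Filter.atTop
        ≤ ENNReal.ofReal (C * μ ^ 2) ∧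
      Filter.limsup (fun i : ℕ => DiffusionLearning.meanSquare P
          (W μ (i * S.T + t))) Filter.atTop ≠ ⊤ ∧
      Filter.limsup (fun i : ℕ => DiffusionLearning.meanSquare P
          (W' μ (i * S.T + t))) Filter.atTop ≠ ⊤ ∧
      |(Filter.limsup (fun i : ℕ => DiffusionLearning.meanSquare P
            (W μ (i * S.T + t))) Filter.atTop).toReal
          - (Filter.limsup (fun i : ℕ => DiffusionLearning.meanSquare P
            (W' μ (i * S.T + t))) Filter.atTop).toReal|
        ≤ C * μ ^ (3 / 2 : ℝ) := by
  have h : S.RiskAndLoss ν (max δ 1) := hJQ.mono (le_max_left _ _)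
  have hδ : 0 < max δ 1 := lt_max_of_lt_right one_pos
  obtain ⟨μ₁, hμ₁, C, hC, hsteady⟩ := henv.exists_steady_state_le hK hT (fun k => (hq k).1) hA h hδ
    hν (h.sum_smul_riskGrad_eq_zero hK hwo) hHess v₀
  refine ⟨min μ₁ 1, by positivity, 3 * C + 1, by positivity, fun μ hμ hμlt t ht1 ht => ?_⟩
  have hμ1 : μ ≤ 1 := hμlt.le.trans (min_le_right _ _)
  have hev := hsteady μ hμ (hμlt.trans_le (min_le_left _ _)) t ht1 ht
  have hWf : ∀ n, W μ n
      = fun ω => S.error wo μ (fun i k => act i k ω) (fun m k => ξ m k ω) n :=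
    fun n => funext fun ω => hW μ n ω
  have hWf' : ∀ n, W' μ n
      = fun ω => S.longTerm wo v₀ μ (fun i k => act i k ω) (fun m k => ξ m k ω) n :=
    fun n => funext fun ω => hW' μ n ω
  have hm : ∀ n, DiffusionLearning.FinitelyMeasurable _ (W μ n) := fun n => by
    rw [hWf]
    exact ((DiffusionLearning.Setup.finitelyMeasurable_model μ n).mono
      (henv.envSigma_le _)).comp fun w k => wo - w k
  have hm' : ∀ n, DiffusionLearning.FinitelyMeasurable _ (W' μ n) := fun n => by
    rw [hWf']
    exact (DiffusionLearning.Setup.finitelyMeasurable_longTerm wo v₀ μ n).mono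
      (henv.envSigma_le _)
  simp only [DiffusionLearning.meanSquare_eq_ofReal (hm _),
    DiffusionLearning.meanSquare_eq_ofReal (hm' _),
    DiffusionLearning.meanSquare_eq_ofReal ((hm _).comp₂ (hm' _) fun x y => x - y)]
  -- the error is the negative of the deviation
  have hdev : ∀ n ω, ‖(WithLp.toLp 2 (W μ n ω) :
      PiLp 2 (fun _ : Fin K => EuclideanSpace ℝ (Fin M)))‖
      = ‖S.deviation wo μ (fun i k => act i k ω) (fun m k => ξ m k ω) n‖ := by
    intro n ω
    rw [← norm_neg, hW]
    congr 1
    ext1 k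
    exact neg_sub _ _
  have hgap : ∀ n ω, (WithLp.toLp 2 (W μ n ω) - WithLp.toLp 2 (W' μ n ω) :
      PiLp 2 (fun _ : Fin K => EuclideanSpace ℝ (Fin M)))
      = S.longTermGap wo v₀ μ (fun i k => act i k ω) (fun m k => ξ m k ω) n := by
    intro n ω
    rw [hW, hW']
    rfl
  have hclose := hev.mono fun i hi => DiffusionLearning.second_moments_close
    ((hm (i * S.T + t)).comp (WithLp.toLp 2)) ((hm' (i * S.T + t)).comp (WithLp.toLp 2)) hμ hμ1
    hC.le (by simpa only [hdev] using hi.1) (by simpa only [hgap] using hi.2)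
  have hc0 : 0 ≤ (3 * C + 1) * μ ^ (3 / 2 : ℝ) := by positivity
  have hbdd := hclose.mono fun i hi => hi.1
  have hbdd' := hclose.mono fun i hi => show _ ≤ (C + 1) * μ + (3 * C + 1) * μ ^ (3 / 2 : ℝ) by
    have := (abs_le.1 hi.2).1
    linarith [hi.1]
  refine ⟨?_, DiffusionLearning.limsup_ofReal_ne_top hbdd,
    DiffusionLearning.limsup_ofReal_ne_top hbdd',
    DiffusionLearning.abs_limsup_ofReal_sub_le
      (fun i => MeasureTheory.integral_nonneg fun ω => by positivity)
      (fun i => MeasureTheory.integral_nonneg fun ω => by positivity) hc0 hbdd hbdd'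
      (hclose.mono fun i hi => hi.2)⟩
  refine Filter.limsup_le_of_le (by isBoundedDefault) (hev.mono fun i hi => ?_)
  refine ENNReal.ofReal_le_ofReal ?_
  simp only [WithLp.toLp_sub, hgap]
  have : 0 ≤ (2 * C + 1) * μ ^ 2 := by positivity
  linarith [hi.2]
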